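/- Let $\Lambda=\mathbb Z[t^{\pm1}]$, and let $L=K_1\cup\dots\cup K_\mu$ ($\mu\ge 1$) be an oriented virtual link with a diagram $D$. Let $A(D)$ be the set of arcs and $C(D)$ the set of classical crossings of $D$. For $c\in C(D)$ let $w(c)=\pm1$ be the writhe, $a(c)$ the overpassing arc, and $b_1(c)$, $b_2(c)$ the underpassing arcs to the right and to the left of $a(c)$. Let $\kappa(a)$ be the index of the component containing the arc $a$. A medial quandle is a set with an operation $\triangleright$ such that $x\triangleright x=x$, every translation $\beta_y:x\mapsto x\triangleright y$ is bijective, and $(w\triangleright x)\triangleright(y\triangleright z)=(w\triangleright y)\triangleright(x\triangleright z)$. Its displacement group is generated by the maps $\beta_y\beta_z^{-1}$. A quandle is semiregular if its only displacement with a fixed point is the identity map. The medial quandle $\mathrm{MQ}(L)$ is generated by elements $q_a$, $a\in A(D)$, subject to the relations $q_{b_2(c)}=q_{b_1(c)}\triangleright q_{a(c)}$, $c\in C(D)$. The reduced Alexander module $M=M_A^{\mathrm{red}}(L)$ is the quotient of the free $\Lambda$-module on $A(D)$ by the elements $(1-t)a(c)+t\,b_1(c)-b_2(c)$, $c\in C(D)$.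 Let $\phi:M\to\Lambda$ be the $\Lambda$-linear map sending every arc to $1$, and let $N=\ker\phi$. Let $\phi_\tau:M\to\Lambda\oplus\mathbb Z^{\mu-1}$ ($t$ acts trivially on $\mathbb Z^{\mu-1}$) be the $\Lambda$-linear map sending an arc $a$ to $(1,0,\dots,0)$ if $\kappa(a)=1$, and to $1$ in the first and $1$ in the $\kappa(a)$-th coordinate, and $0$ elsewhere, if $\kappa(a)>1$. A meridian of $K_i$ is an $x\in M$ with $\phi_\tau(x)=\phi_\tau(a)$ for some arc $a$ of $K_i$. The longitude of $K_i$ is the class $\chi_i\in M$ of $$\sum_{\kappa(b_1(c))=i}w(c)\,a(c)-\tfrac12\sum_{\kappa(b_1(c))=i}w(c)\,\bigl(b_1(c)+b_2(c)\bigr).$$ Let $m_i$ be any meridian of $K_i$, and $X_i=\Lambda\chi_i$, for $1\le i\le\mu$. Let $Q(N,(m_i),(X_i))$ be the disjoint union of the sets $Q_i=N/X_i$, with $x\triangleright y=m_j-m_i+tx+(1-t)y+X_i\in Q_i$ for $x\in Q_i$, $y\in Q_j$. Give $M$ the operation $x\triangleright y=tx+(1-t)y$. The map $Q(N,(m_i),(X_i))\to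 M$ given by $x\mapsto m_i+(1-t)x$ for $x\in Q_i$ is a quandle map; its image is the natural quasi-affine image $Q_A^{\mathrm{red}}(L)=\bigcup_i\bigl(m_i+(1-t)N\bigr)$. **Theorem.** There is a quandle isomorphism $e:\mathrm{MQ}(L)\to Q(N,(m_i),(X_i))$. For every such isomorphism $e$, let $f:\mathrm{MQ}(L)\to Q_A^{\mathrm{red}}(L)$ be the natural map, i.e. the composition of $e$ with $x\mapsto m_i+(1-t)x$ ($x\in Q_i$). Then $Q_A^{\mathrm{red}}(L)$ is the maximal semiregular image of $\mathrm{MQ}(L)$: the map $f$ is surjective, $Q_A^{\mathrm{red}}(L)$ is a semiregular medial quandle, and for every semiregular medial quandle $Q$ and every surjective quandle map $g:\mathrm{MQ}(L)\to Q$ there is a unique quandle map $g':Q_A^{\mathrm{red}}(L)\to Q$ with $g=g'\circ f$. -/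

import Mathlib

open scoped LaurentPolynomial Quandles

noncomputable section

/-! ## Displacements, semiregularity, subquandles

The right-handed quandle operation `x ▷ y` is Mathlib's `y ◃ x`, so the translation `β_y` is `Rack.act' y`.
A medial quandle is a `Quandle` satisfying `Rack.IsAbelian`. -/

/-- The displacement group: generated by the elementary displacements `β_y β_z⁻¹`. -/
def Dis (Q : Type*) [Quandle Q] : Subgroup (Equiv.Perm Q) :=
  Subgroup.closure {d | ∃ y z : Q, d = Rack.act' y * (Rack.act' z)⁻¹}

/-- The only displacement with a fixed point is the identity. -/
def Semiregular (Q : Type*) [Quandle Q] : Prop :=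
  ∀ d ∈ Dis Q, (∃ x, d x = x) → d = 1

theorem ShelfHom.map_invAct {Q R : Type*} [Quandle Q] [Quandle R] (f : Q →◃ R) (x y : Q) :
    f (x ◃⁻¹ y) = f x ◃⁻¹ f y := by
  rw [← Rack.left_cancel (f x), ← ShelfHom.map_act, Rack.act_invAct_eq, Rack.act_invAct_eq]

/-- The image of a quandle map, as a type. -/
def QuandleImage {Q R : Type*} [Quandle Q] [Quandle R] (f : Q →◃ R) : Type _ :=
  {y : R // ∃ x, f x = y}

/-- The image of a quandle map is a subquandle of the codomain. -/
instance QuandleImage.instQuandle {Q R : Type*} [Quandle Q] [Quandle R] (f : Q →◃ R) :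
    Quandle (QuandleImage f) where
  act a b := ⟨a.1 ◃ b.1, by
    obtain ⟨_, x, rfl⟩ := a
    obtain ⟨_, y, rfl⟩ := b
    exact ⟨x ◃ y, f.map_act⟩⟩
  self_distrib := Subtype.ext Shelf.self_distrib
  invAct a b := ⟨a.1 ◃⁻¹ b.1, by
    obtain ⟨_, x, rfl⟩ := a
    obtain ⟨_, y, rfl⟩ := b
    exact ⟨x ◃⁻¹ y, f.map_invAct x y⟩⟩
  left_inv a b := Subtype.ext (Rack.left_inv a.1 b.1)
  right_inv a b := Subtype.ext (Rack.right_inv a.1 b.1)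
  fix := Subtype.ext Quandle.fix

/-- A quandle map, with codomain restricted to its image. -/
def QuandleImage.mk {Q R : Type*} [Quandle Q] [Quandle R] (f : Q →◃ R) :
    Q →◃ QuandleImage f where
  toFun x := ⟨f x, x, rfl⟩
  map_act' := Subtype.ext f.map_act

/-! ## Laurent polynomials and affine quandles -/

/-- `Λ = ℤ[t, t⁻¹]`. -/
abbrev Lam : Type := ℤ[T;T⁻¹]

/-- The variable `t`. -/
abbrev tt : Lam := LaurentPolynomial.T 1

/-- The inverse `t⁻¹`. -/
abbrev ti : Lam := LaurentPolynomial.T (-1)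

theorem tt_mul_ti : tt * ti = 1 := by
  rw [← LaurentPolynomial.T_add, add_neg_cancel, LaurentPolynomial.T_zero]

theorem tt_smul_ti {M : Type*} [AddCommGroup M] [Module Lam M] (x : M) : tt • ti • x = x := by
  rw [smul_smul, tt_mul_ti, one_smul]

theorem ti_smul_tt {M : Type*} [AddCommGroup M] [Module Lam M] (x : M) : ti • tt • x = x := by
  rw [smul_smul, mul_comm, tt_mul_ti, one_smul]

/-- The carrier of the standard Alexander (affine) quandle on a `Λ`-module. -/
def Affine (M : Type*) : Type _ := M

/-- `x ▷ y = t x + (1 - t) y` and `x ▷⁻¹ y = t⁻¹ x + (1 - t⁻¹) y`. -/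
instance Affine.instQuandle (M : Type*) [AddCommGroup M] [Module Lam M] : Quandle (Affine M) where
  act (y x : M) := (tt • x + (1 - tt) • y : M)
  self_distrib {x y z : M} := by
    change (tt • (tt • z + (1 - tt) • y) + (1 - tt) • x : M) =
      tt • (tt • z + (1 - tt) • x) + (1 - tt) • (tt • y + (1 - tt) • x)
    module
  invAct (y x : M) := (ti • x + (1 - ti) • y : M)
  left_inv (y x : M) := by
    change (ti • (tt • x + (1 - tt) • y) + (1 - ti) • y : M) = x
    simp only [smul_add, sub_smul, smul_sub, one_smul, ti_smul_tt]
    abel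
  right_inv (y x : M) := by
    change (tt • (ti • x + (1 - ti) • y) + (1 - tt) • y : M) = x
    simp only [smul_add, sub_smul, smul_sub, one_smul, tt_smul_ti]
    abel
  fix {x : M} := by
    change (tt • x + (1 - tt) • x : M) = x
    module

/-! ## The medial quandle `Q(N, (m_i), (X_i))` -/

/-- The data from which `Q(N, (m_i), (X_i))` is built. -/
structure PeripheralData (M : Type*) [AddCommGroup M] [Module Lam M] (I : Type*) where
  N : Submodule Lam M
  m : I → M
  X : I → Submodule Lam M
  m_sub_mem : ∀ i j, m i - m j ∈ N
  X_le : ∀ i, X i ≤ N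
  smul_X : ∀ i, ∀ x ∈ X i, (1 - tt) • x = 0

namespace PeripheralData

variable {M : Type*} [AddCommGroup M] [Module Lam M] {I : Type*} (P : PeripheralData M I)

/-- `Q_i = N / X_i`. -/
abbrev Piece (i : I) : Type _ := P.N ⧸ (P.X i).submoduleOf P.N

/-- The underlying set of `Q(N, (m_i), (X_i))`: the disjoint union of the `N / X_i`. -/
def Carrier : Type _ := Σ i, P.Piece i

/-- `m_j - m_i` as an element of `N`. -/
def diff (j i : I) : P.N := ⟨P.m j - P.m i, P.m_sub_mem j i⟩

/-- The map `N / X_j → N / X_i` sending `y` to `(1 - t) y + X_i`. -/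
def cross (j i : I) : P.Piece j →ₗ[Lam] P.Piece i :=
  Submodule.liftQ _ ((1 - tt) • Submodule.mkQ ((P.X i).submoduleOf P.N)) (by
    intro x hx
    have h : (1 - tt) • x = 0 := Subtype.ext (P.smul_X j x.1 hx)
    rw [LinearMap.mem_ker, LinearMap.smul_apply, ← map_smul, h, map_zero])

theorem cross_mk (j i : I) (y : P.N) :
    P.cross j i (Submodule.Quotient.mk y) = Submodule.Quotient.mk ((1 - tt) • y) := rfl

/-- `x ▷ y = m_j - m_i + t x + (1 - t) y + X_i` for `x ∈ Q_i`, `y ∈ Q_j`. -/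
def act (y x : P.Carrier) : P.Carrier :=
  ⟨x.1, Submodule.Quotient.mk (P.diff y.1 x.1) + tt • x.2 + P.cross y.1 x.1 y.2⟩

/-- `x ▷⁻¹ y = t⁻¹ (m_i - m_j + x - (1 - t) y) + X_i` for `x ∈ Q_i`, `y ∈ Q_j`. -/
def invAct (y x : P.Carrier) : P.Carrier :=
  ⟨x.1, ti • (Submodule.Quotient.mk (P.diff x.1 y.1) + x.2 - P.cross y.1 x.1 y.2)⟩

theorem diff_neg (i j : I) : P.diff i j = - P.diff j i :=
  Subtype.ext (neg_sub _ _).symm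

instance instQuandle : Quandle P.Carrier where
  act := P.act
  invAct := P.invAct
  self_distrib {x y z} := by
    obtain ⟨i, x⟩ := x
    obtain ⟨j, y⟩ := y
    obtain ⟨k, z⟩ := z
    obtain ⟨x, rfl⟩ := Submodule.Quotient.mk_surjective _ x
    obtain ⟨y, rfl⟩ := Submodule.Quotient.mk_surjective _ y
    obtain ⟨z, rfl⟩ := Submodule.Quotient.mk_surjective _ z
    simp only [act, cross_mk, ← Submodule.Quotient.mk_smul, ← Submodule.Quotient.mk_add]
    refine Sigma.ext rfl (heq_of_eq (congrArg Submodule.Quotient.mk (Subtype.ext ?_)))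
    simp only [diff, Submodule.coe_add, Submodule.coe_smul]
    module
  left_inv y x := by
    obtain ⟨i, x⟩ := x
    obtain ⟨j, y⟩ := y
    refine Sigma.ext rfl (heq_of_eq ?_)
    simp only [act, invAct]
    rw [P.diff_neg i j, Submodule.Quotient.mk_neg]
    refine Eq.trans ?_ (ti_smul_tt x)
    congr 1
    abel
  right_inv y x := by
    obtain ⟨i, x⟩ := x
    obtain ⟨j, y⟩ := y
    refine Sigma.ext rfl (heq_of_eq ?_)
    simp only [act, invAct]
    rw [tt_smul_ti, P.diff_neg i j, Submodule.Quotient.mk_neg]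
    abel
  fix {x} := by
    obtain ⟨i, x⟩ := x
    obtain ⟨x, rfl⟩ := Submodule.Quotient.mk_surjective _ x
    simp only [act, cross_mk, ← Submodule.Quotient.mk_smul, ← Submodule.Quotient.mk_add]
    congr 2
    apply Subtype.ext
    simp only [diff, Submodule.coe_add, Submodule.coe_smul]
    module

/-- `(1 - t) x ∈ M` for `x ∈ N / X_i`. -/
def oneSub (i : I) : P.Piece i →ₗ[Lam] M :=
  Submodule.liftQ _ ((1 - tt) • P.N.subtype) (by
    intro x hx
    exact P.smul_X i x.1 hx)

theorem oneSub_mk (i : I) (y : P.N) :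
    P.oneSub i (Submodule.Quotient.mk y) = (1 - tt) • (y : M) := rfl

/-- The natural map `f : Q(N, (m_i), (X_i)) → M`, with `f x = m_i + (1 - t) x` for `x ∈ Q_i`. -/
def natMap : P.Carrier →◃ Affine M where
  toFun x := (P.m x.1 + P.oneSub x.1 x.2 : M)
  map_act' {x y} := by
    obtain ⟨i, x⟩ := x
    obtain ⟨j, y⟩ := y
    obtain ⟨x, rfl⟩ := Submodule.Quotient.mk_surjective _ x
    obtain ⟨y, rfl⟩ := Submodule.Quotient.mk_surjective _ y
    change (P.m j + P.oneSub j (Submodule.Quotient.mk (P.diff i j + tt • y + (1 - tt) • x)) : M) =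
      tt • (P.m j + P.oneSub j (Submodule.Quotient.mk y)) +
        (1 - tt) • (P.m i + P.oneSub i (Submodule.Quotient.mk x))
    simp only [oneSub_mk, diff, Submodule.coe_add, Submodule.coe_smul]
    module

/-- The natural quasi-affine image of `Q(N, (m_i), (X_i))`. -/
abbrev NaturalImage : Type _ := QuandleImage P.natMap

end PeripheralData

/-! ## Medial quandles given by generators and relations -/

/-- Formal expressions in generators `A` and the operations `◃`, `◃⁻¹`. -/
inductive QTerm (A : Type) : Type
  | gen (a : A) : QTerm A
  | act (x y : QTerm A) : QTerm A
  | invAct (x y : QTerm A) : QTerm A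

/-- The congruence generated by the medial quandle axioms and the relations `r`. -/
inductive MedialRel {A : Type} (r : QTerm A → QTerm A → Prop) : QTerm A → QTerm A → Prop
  | rel {x y} (h : r x y) : MedialRel r x y
  | refl (x) : MedialRel r x x
  | symm {x y} (h : MedialRel r x y) : MedialRel r y x
  | trans {x y z} (h : MedialRel r x y) (h' : MedialRel r y z) : MedialRel r x z
  | congr_act {x x' y y'} (h : MedialRel r x x') (h' : MedialRel r y y') :
      MedialRel r (.act x y) (.act x' y')
  | congr_invAct {x x' y y'} (h : MedialRel r x x') (h' : MedialRel r y y') :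
      MedialRel r (.invAct x y) (.invAct x' y')
  | idem (x) : MedialRel r (.act x x) x
  | invAct_act (x y) : MedialRel r (.invAct x (.act x y)) y
  | act_invAct (x y) : MedialRel r (.act x (.invAct x y)) y
  | medial (x y z w) :
      MedialRel r (.act (.act x y) (.act z w)) (.act (.act x z) (.act y w))

/-- The setoid of `MedialRel r`. -/
def medialSetoid {A : Type} (r : QTerm A → QTerm A → Prop) : Setoid (QTerm A) :=
  ⟨MedialRel r, MedialRel.refl, MedialRel.symm, MedialRel.trans⟩

/-- The medial quandle generated by `A` subject to the relations `r`. -/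
def PresentedMedialQuandle {A : Type} (r : QTerm A → QTerm A → Prop) : Type :=
  Quotient (medialSetoid r)

instance PresentedMedialQuandle.instQuandle {A : Type} (r : QTerm A → QTerm A → Prop) :
    Quandle (PresentedMedialQuandle r) where
  act := Quotient.map₂ QTerm.act fun _ _ h _ _ h' => MedialRel.congr_act h h'
  invAct := Quotient.map₂ QTerm.invAct fun _ _ h _ _ h' => MedialRel.congr_invAct h h'
  self_distrib {x y z} := by
    induction x using Quotient.ind
    induction y using Quotient.ind
    induction z using Quotient.ind
    exact Quotient.sound
      ((MedialRel.congr_act (MedialRel.idem _).symm (MedialRel.refl _)).trans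
        (MedialRel.medial _ _ _ _))
  left_inv x y := by
    induction x using Quotient.ind
    induction y using Quotient.ind
    exact Quotient.sound (MedialRel.invAct_act _ _)
  right_inv x y := by
    induction x using Quotient.ind
    induction y using Quotient.ind
    exact Quotient.sound (MedialRel.act_invAct _ _)
  fix {x} := by
    induction x using Quotient.ind
    exact Quotient.sound (MedialRel.idem _)

/-! ## Oriented virtual link diagrams -/

/-- An oriented virtual link diagram with components `K_i`, `i : Fin μ`, recorded by its Gauss
diagram.  A classical crossing `c` is passed twice: `(c, true)` is the passage along the
overpassing strand, `(c, false)` the one along the underpassing strand.  `next p` is the classical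
passage that follows `p` along the orientation of its component (virtual crossings leave no trace),
`comp p` the component on which `p` lies, and `writhe c` the sign of `c`.  A component that is not
of the form `comp p` is a curve without classical crossings. -/
structure LinkDiagram (μ : ℕ) where
  crossings : ℕ
  writhe : Fin crossings → ℤˣ
  next : Equiv.Perm (Fin crossings × Bool)
  comp : Fin crossings × Bool → Fin μ
  comp_eq_iff : ∀ p q, comp p = comp q ↔ next.SameCycle p q

namespace LinkDiagram

variable {μ : ℕ} (D : LinkDiagram μ)

/-- The set `C(D)` of classical crossings. -/
abbrev Crossing : Type := Fin D.crossings

/-- Passages through classical crossings. -/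
abbrev Passage : Type := D.Crossing × Bool

/-- The pieces into which the classical crossings divide the curves: `inl p` is the piece from
the passage `p` to the passage `next p`, and `inr i` is a whole curve without classical
crossings. -/
abbrev Segment : Type := D.Passage ⊕ {i : Fin μ // ∀ p, D.comp p ≠ i}

/-- Two consecutive segments are joined when they meet at an overpass. -/
inductive Joined : D.Segment → D.Segment → Prop
  | over (p : D.Passage) (h : (D.next p).2 = true) : Joined (.inl p) (.inl (D.next p))

/-- The set `A(D)` of (long) arcs, cut only at the underpasses. -/
def Arc : Type := Quot D.Joined

/-- The arc containing a segment. -/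
def arcOf (s : D.Segment) : D.Arc := Quot.mk _ s

/-- The overpassing arc `a(c)`. -/
def a (c : D.Crossing) : D.Arc := D.arcOf (.inl (c, true))

/-- The underpassing arc that ends at `c`. -/
def inArc (c : D.Crossing) : D.Arc := D.arcOf (.inl (D.next.symm (c, false)))

/-- The underpassing arc that starts at `c`. -/
def outArc (c : D.Crossing) : D.Arc := D.arcOf (.inl (c, false))

/-- The underpassing arc `b₁(c)` on the right of the overpassing arc: at a positive crossing the
underpassing strand runs from right to left, at a negative one from left to right. -/
def b₁ (c : D.Crossing) : D.Arc := if D.writhe c = 1 then D.inArc c else D.outArc c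

/-- The underpassing arc `b₂(c)` on the left of the overpassing arc. -/
def b₂ (c : D.Crossing) : D.Arc := if D.writhe c = 1 then D.outArc c else D.inArc c

theorem comp_next (p : D.Passage) : D.comp (D.next p) = D.comp p :=
  ((D.comp_eq_iff _ _).2 ⟨1, by simp⟩).symm

/-- The component `κ_D(a)` of an arc. -/
def κ : D.Arc → Fin μ :=
  Quot.lift (Sum.elim D.comp Subtype.val) (by
    rintro _ _ ⟨p, _⟩
    exact (D.comp_next p).symm)

theorem κ_inArc (c : D.Crossing) : D.κ (D.inArc c) = D.comp (c, false) := by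
  have h := D.comp_next (D.next.symm (c, false))
  rw [Equiv.apply_symm_apply] at h
  exact h.symm

theorem κ_outArc (c : D.Crossing) : D.κ (D.outArc c) = D.comp (c, false) := rfl

theorem κ_b₁ (c : D.Crossing) : D.κ (D.b₁ c) = D.comp (c, false) := by
  unfold b₁; split_ifs <;> simp [κ_inArc, κ_outArc]

theorem κ_b₂ (c : D.Crossing) : D.κ (D.b₂ c) = D.comp (c, false) := by
  unfold b₂; split_ifs <;> simp [κ_inArc, κ_outArc]

theorem κ_surjective (i : Fin μ) : ∃ b, D.κ b = i := by
  by_cases h : ∃ p, D.comp p = i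
  · obtain ⟨p, hp⟩ := h
    exact ⟨D.arcOf (.inl p), hp⟩
  · push Not at h
    exact ⟨D.arcOf (.inr ⟨i, h⟩), rfl⟩

/-! ### The medial quandle of a link -/

/-- The crossing relations `q_{b₂(c)} = q_{b₁(c)} ▷ q_{a(c)}`. -/
inductive CrossingRel : QTerm D.Arc → QTerm D.Arc → Prop
  | mk (c : D.Crossing) :
      CrossingRel (.gen (D.b₂ c)) (.act (.gen (D.a c)) (.gen (D.b₁ c)))

/-- The medial quandle `MQ(L)`. -/
abbrev MQ : Type := PresentedMedialQuandle D.CrossingRel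

/-! ### The reduced Alexander module -/

/-- The basis element of `Λ^{A(D)}` given by an arc. -/
abbrev e (b : D.Arc) : D.Arc →₀ Lam := Finsupp.single b 1

/-- `ϱ_D(c) = (1 - t) a(c) + t b₁(c) - b₂(c)`. -/
def rho : (D.Crossing →₀ Lam) →ₗ[Lam] (D.Arc →₀ Lam) :=
  Finsupp.linearCombination Lam fun c =>
    (1 - tt) • D.e (D.a c) + tt • D.e (D.b₁ c) - D.e (D.b₂ c)

/-- The reduced Alexander module `M_A^red(L) = coker ϱ_D`. -/
abbrev AlexMod : Type := (D.Arc →₀ Lam) ⧸ LinearMap.range D.rho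

/-- The canonical map `ς_D : Λ^{A(D)} → M_A^red(L)`. -/
def sig : (D.Arc →₀ Lam) →ₗ[Lam] D.AlexMod := Submodule.mkQ _

/-- A linear map on `Λ^{A(D)}` that respects the crossing relations vanishes on `im ϱ_D`. -/
theorem range_rho_le {V : Type*} [AddCommGroup V] [Module Lam V] (F : D.Arc → V)
    (hF : ∀ c, (1 - tt) • F (D.a c) + tt • F (D.b₁ c) - F (D.b₂ c) = 0) :
    LinearMap.range D.rho ≤ LinearMap.ker (Finsupp.linearCombination Lam F) := by
  rw [LinearMap.range_le_ker_iff]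
  apply Finsupp.lhom_ext
  intro c r
  simp only [rho, LinearMap.comp_apply, Finsupp.linearCombination_single, map_smul, map_add,
    map_sub, one_smul, hF, smul_zero, LinearMap.zero_apply]

/-- The map `φ_L^red : M_A^red(L) → Λ` sending every arc to `1`. -/
def phi : D.AlexMod →ₗ[Lam] Lam :=
  Submodule.liftQ _ (Finsupp.linearCombination Lam fun _ => (1 : Lam))
    (D.range_rho_le _ fun c => by simp only [smul_eq_mul]; ring)

end LinkDiagram

/-- The abelian group `ℤ`, as a `Λ`-module on which `t` acts trivially. -/
def TrivZ : Type := ℤ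

instance : AddCommGroup TrivZ := inferInstanceAs (AddCommGroup ℤ)

/-- The ring homomorphism `Λ → ℤ`, `t ↦ 1`. -/
def aug : Lam →+* ℤ := LaurentPolynomial.eval₂ (RingHom.id ℤ) 1

theorem aug_tt : aug tt = 1 := by simp [aug]

instance : Module Lam TrivZ := Module.compHom ℤ aug

theorem tt_smul_trivZ (n : TrivZ) : tt • n = n := by
  change aug tt • (n : ℤ) = n
  rw [aug_tt, one_smul]

/-- The element `1` of `TrivZ`. -/
def TrivZ.one : TrivZ := (1 : ℤ)

namespace LinkDiagram

variable {μ : ℕ} (D : LinkDiagram μ)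

/-- `A_μ = Λ ⊕ ℤ^{μ-1}`; the coordinates of `ℤ^{μ-1}` are indexed by the components other than
the first one. -/
abbrev AMu (μ : ℕ) [NeZero μ] : Type := Lam × ({j : Fin μ // j ≠ 0} → TrivZ)

/-- `F(a) = (1, 0, …, 0)` if `κ_D(a)` is the first component; otherwise `F(a)` has a second `1` in
the coordinate of `κ_D(a)`. -/
def arcValue [NeZero μ] (i : Fin μ) : AMu μ :=
  (1, fun j => if j.1 = i then TrivZ.one else 0)

/-- The map `φ_τ : M_A^red(L) → A_μ`. -/
def phiTau [NeZero μ] : D.AlexMod →ₗ[Lam] AMu μ :=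
  Submodule.liftQ _ (Finsupp.linearCombination Lam fun b => arcValue (D.κ b))
    (D.range_rho_le _ fun c => by
      rw [D.κ_b₁, D.κ_b₂]
      refine Prod.ext ?_ (funext fun j => ?_)
      · simp only [arcValue, Prod.fst_sub, Prod.fst_add, Prod.smul_fst, smul_eq_mul,
          Prod.fst_zero]
        ring
      · simp only [arcValue, Prod.snd_sub, Prod.snd_add, Prod.smul_snd, Pi.sub_apply,
          Pi.add_apply, Pi.smul_apply, sub_smul, one_smul, tt_smul_trivZ, Prod.snd_zero,
          Pi.zero_apply]
        abel)

/-- `x` is a meridian of `K_i` if `φ_τ(x) = φ_τ(a)` for some arc `a` of `K_i`. -/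
def IsMeridian [NeZero μ] (i : Fin μ) (x : D.AlexMod) : Prop :=
  ∃ b, D.κ b = i ∧ D.phiTau x = D.phiTau (D.sig (D.e b))

/-! ### Longitudes -/

/-- The crossings at which `K_i` underpasses, i.e. `κ_D(b₁(c)) = i`. -/
def underCrossings (i : Fin μ) : Finset D.Crossing :=
  Finset.univ.filter fun c => D.κ (D.b₁ c) = i

/-- Half of `∑ w(c) (b₁(c) + b₂(c))`, the sum over the underpasses of `K_i`. -/
def halfSum (i : Fin μ) : D.Arc →₀ Lam :=
  ∑ c ∈ D.underCrossings i, (D.writhe c : ℤ) • D.e (D.b₁ c)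

/-- Each arc of `K_i` that ends at an underpass also starts at one. -/
theorem sum_inArc_eq_sum_outArc (i : Fin μ) :
    ∑ c ∈ D.underCrossings i, D.e (D.inArc c) = ∑ c ∈ D.underCrossings i, D.e (D.outArc c) := by
  have key : ∑ p : D.Passage, (if D.comp p = i then
      D.e (D.arcOf (.inl (D.next.symm p))) - D.e (D.arcOf (.inl p)) else 0) = 0 := by
    have h1 : ∀ p, D.comp (D.next.symm p) = D.comp p := fun p => by
      have h := D.comp_next (D.next.symm p)
      rw [Equiv.apply_symm_apply] at h
      exact h.symm
    have h2 := Equiv.sum_comp D.next.symm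
      (fun p => if D.comp p = i then D.e (D.arcOf (.inl p)) else 0)
    simp only [h1] at h2
    rw [← sub_eq_zero, ← Finset.sum_sub_distrib] at h2
    refine Eq.trans ?_ h2
    refine Finset.sum_congr rfl fun p _ => ?_
    split_ifs <;> simp
  rw [Fintype.sum_prod_type] at key
  rw [← sub_eq_zero, ← Finset.sum_sub_distrib, underCrossings, Finset.sum_filter]
  refine Eq.trans ?_ key
  refine Finset.sum_congr rfl fun c _ => ?_
  have h3 : D.arcOf (.inl (D.next.symm (c, true))) = D.arcOf (.inl (c, true)) := by
    have h := Quot.sound (Joined.over (D.next.symm (c, true)) (by simp))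
    rw [Equiv.apply_symm_apply] at h
    exact h
  rw [Fintype.sum_bool, h3, sub_self, ite_self, zero_add, D.κ_b₁]
  rfl

/-- `∑ w(c) (b₂(c) - b₁(c)) = 0`, the sum over the underpasses of `K_i`. -/
theorem sum_b₂_sub_b₁ (i : Fin μ) :
    ∑ c ∈ D.underCrossings i, (D.writhe c : ℤ) • (D.e (D.b₂ c) - D.e (D.b₁ c)) = 0 := by
  rw [← sub_eq_zero.2 (D.sum_inArc_eq_sum_outArc i).symm, ← Finset.sum_sub_distrib]
  refine Finset.sum_congr rfl fun c _ => ?_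
  rcases Int.units_eq_one_or (D.writhe c) with h | h <;> simp [b₁, b₂, h]

/-- `halfSum` is the half of the sum: it is the unique element with this property, because
`Λ^{A(D)}` is torsion-free. -/
theorem two_smul_halfSum (i : Fin μ) :
    (2 : ℤ) • D.halfSum i =
      ∑ c ∈ D.underCrossings i, (D.writhe c : ℤ) • (D.e (D.b₁ c) + D.e (D.b₂ c)) := by
  rw [← add_zero ((2 : ℤ) • D.halfSum i), ← D.sum_b₂_sub_b₁ i, halfSum, Finset.smul_sum,
    ← Finset.sum_add_distrib]
  refine Finset.sum_congr rfl fun c _ => ?_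
  module

/-- The longitude `χ_i(L)` of `K_i` in `M_A^red(L)`. -/
def longitude (i : Fin μ) : D.AlexMod :=
  D.sig (∑ c ∈ D.underCrossings i, (D.writhe c : ℤ) • D.e (D.a c) - D.halfSum i)

theorem phi_sig_e (b : D.Arc) : D.phi (D.sig (D.e b)) = 1 := by
  change Finsupp.linearCombination Lam (fun _ => (1 : Lam)) (D.e b) = 1
  simp

theorem phi_longitude (i : Fin μ) : D.phi (D.longitude i) = 0 := by
  simp only [longitude, halfSum, map_sub, map_sum, map_zsmul, phi_sig_e, sub_self]

theorem sig_crossing (c : D.Crossing) :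
    (1 - tt) • D.sig (D.e (D.a c)) = D.sig (D.e (D.b₂ c)) - tt • D.sig (D.e (D.b₁ c)) := by
  have h : D.sig ((1 - tt) • D.e (D.a c) + tt • D.e (D.b₁ c) - D.e (D.b₂ c)) = 0 := by
    refine (Submodule.Quotient.mk_eq_zero _).2 ⟨Finsupp.single c 1, ?_⟩
    simp [rho]
  simp only [map_sub, map_add, map_smul] at h
  rw [← sub_eq_zero, ← h]
  abel

theorem one_sub_smul_longitude (i : Fin μ) : (1 - tt) • D.longitude i = 0 := by
  have h := congrArg D.sig (D.sum_b₂_sub_b₁ i)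
  simp only [map_sum, map_zsmul, map_sub, map_zero] at h
  rw [← h, longitude, halfSum, ← Finset.sum_sub_distrib, map_sum, Finset.smul_sum]
  refine Finset.sum_congr rfl fun c _ => ?_
  rw [map_sub, map_zsmul, map_zsmul, smul_sub, smul_comm (1 - tt) (D.writhe c : ℤ),
    smul_comm (1 - tt) (D.writhe c : ℤ), sig_crossing]
  module

theorem IsMeridian.phi_eq [NeZero μ] {i : Fin μ} {x : D.AlexMod} (h : D.IsMeridian i x) :
    D.phi x = 1 := by
  have hfst : ∀ y, (D.phiTau y).1 = D.phi y := by
    intro y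
    obtain ⟨y, rfl⟩ := Submodule.Quotient.mk_surjective _ y
    change (LinearMap.fst Lam Lam ({j : Fin μ // j ≠ 0} → TrivZ) ∘ₗ
      Finsupp.linearCombination Lam fun b => (arcValue (D.κ b) : AMu μ)) y =
      Finsupp.linearCombination Lam (fun _ => (1 : Lam)) y
    congr 1
    apply Finsupp.lhom_ext
    intro b r
    simp [arcValue]
  obtain ⟨b, _, hb⟩ := h
  rw [← hfst, hb, hfst, phi_sig_e]

/-- The data `(ker φ_L^red, m_1, …, m_μ, X_1, …, X_μ)`, where `m_i` is a meridian of `K_i` and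
`X_i` is the submodule generated by the longitude `χ_i(L)`. -/
def peripheral [NeZero μ] (m : Fin μ → D.AlexMod) (hm : ∀ i, D.IsMeridian i (m i)) :
    PeripheralData D.AlexMod (Fin μ) where
  N := LinearMap.ker D.phi
  m := m
  X i := Submodule.span Lam {D.longitude i}
  m_sub_mem i j := by
    rw [LinearMap.mem_ker, map_sub, (hm i).phi_eq, (hm j).phi_eq, sub_self]
  X_le i := by
    rw [Submodule.span_singleton_le_iff_mem, LinearMap.mem_ker, phi_longitude]
  smul_X i x hx := by
    obtain ⟨r, rfl⟩ := Submodule.mem_span_singleton.1 hx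
    rw [smul_comm, one_sub_smul_longitude, smul_zero]

/-- `Q_A^red(L)`: the natural quasi-affine image of
`Q(ker φ_L^red, m_1, …, m_μ, X_1, …, X_μ)`. -/
abbrev QAred [NeZero μ] (m : Fin μ → D.AlexMod) (hm : ∀ i, D.IsMeridian i (m i)) : Type :=
  (D.peripheral m hm).NaturalImage

/-- The natural map `MQ(L) → Q_A^red(L)`, when `MQ(L)` is identified with
`Q(ker φ_L^red, m_1, …, m_μ, X_1, …, X_μ)` through `e`. -/
def naturalMap [NeZero μ] (m : Fin μ → D.AlexMod) (hm : ∀ i, D.IsMeridian i (m i))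
    (e : D.MQ →◃ (D.peripheral m hm).Carrier) : D.MQ →◃ D.QAred m hm :=
  (QuandleImage.mk (D.peripheral m hm).natMap).comp e

end LinkDiagram

end

noncomputable section

/-! ## Modules over `Λ` -/

/-! Write `nat z` for the value in M of the natural map. The operation of Q(N, (m_i), (X_i)) is
translation by a difference of such values, `y ◃ z = (nat y - nat z) +ᵥ z` (`act_eq_vadd`), so β_y
β_z⁻¹ is translation by nat y - nat z.

Isomorphism. In a medial quandle the displacement group is commutative, and conjugation by any
translation β_x gives one and the same action of t. For MQ(L) the crossing relations make b ↦ β_b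
β_{b₀}⁻¹ a Λ-linear map `disHom` from M to the displacements. In the other direction, an underpass
moves a generator by w(c)(a(c) - b₁(c)), and the total over one turn around K_i is χ_i, so the
generators have consistent coordinates in N/X_i (`exists_generator_images`). The resulting map
carries displacements to translations by elements of N (`map_dis`). It is bijective because N is
transitive on each N/X_i with stabilizer X_i = Λχ_i, while χ_i already fixes the generators of K_i
in MQ(L).

Universal property. A quandle map g from Q(N, (m_i), (X_i)) to a semiregular quandle turns every
translation by N into a displacement, because N is generated by the differences of meridians
together with (1-t)N. Translation by an element of X_i fixes Q_i pointwise, so by semiregularity g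
is invariant under it everywhere, hence under the sum of all X_i. That sum is exactly the kernel of
1-t (`mem_iSup_longitude`), which is the ambiguity of x ↦ m_i + (1-t)x on one piece; different
pieces have disjoint images because φ_τ separates them. Hence g factors through the natural image
(`eq_of_nat_eq`). -/

theorem C_smul_eq_zsmul {V : Type*} [AddCommGroup V] [Module Lam V] (a : ℤ) (x : V) :
    (LaurentPolynomial.C a : Lam) • x = a • x := by
  rw [show (LaurentPolynomial.C a : Lam) = (a : Lam) from map_intCast LaurentPolynomial.C a,
    Int.cast_smul_eq_zsmul]

/-- An additive subgroup stable under `t` and `t⁻¹` is stable under `Λ`. -/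
theorem AddSubgroup.lam_smul_mem {V : Type*} [AddCommGroup V] [Module Lam V] (S : AddSubgroup V)
    (ht : ∀ x ∈ S, tt • x ∈ S) (hti : ∀ x ∈ S, ti • x ∈ S) (r : Lam) {x : V} (hx : x ∈ S) :
    r • x ∈ S := by
  induction r using LaurentPolynomial.induction_on generalizing x with
  | h_C a =>
    rw [C_smul_eq_zsmul]
    exact S.zsmul_mem hx a
  | h_add h h' =>
    rw [add_smul]
    exact S.add_mem (h hx) (h' hx)
  | h_C_mul_T n a h =>
    rw [LaurentPolynomial.T_add, ← mul_assoc, mul_smul]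
    exact h (ht x hx)
  | h_C_mul_T_Z n a h =>
    rw [LaurentPolynomial.T_sub, ← mul_assoc, mul_smul]
    exact h (hti x hx)

/-- A Laurent polynomial is congruent to its augmentation modulo `1 - t`. -/
theorem exists_eq_aug_add (r : Lam) : ∃ s : Lam, r = (aug r : Lam) + (1 - tt) * s := by
  let S : AddSubgroup Lam :=
    { carrier := {r | ∃ s : Lam, r = (aug r : Lam) + (1 - tt) * s}
      zero_mem' := ⟨0, by simp⟩
      add_mem' := by
        rintro x y ⟨s, hs⟩ ⟨s', hs'⟩
        refine ⟨s + s', ?_⟩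
        nth_rw 1 [hs, hs']
        push_cast [map_add]
        ring
      neg_mem' := by
        rintro x ⟨s, hs⟩
        refine ⟨-s, ?_⟩
        nth_rw 1 [hs]
        push_cast [map_neg]
        ring }
  have haugti : aug ti = 1 := by simp [aug]
  have h : r • (1 : Lam) ∈ S := by
    refine S.lam_smul_mem ?_ ?_ r ⟨0, by simp⟩
    · rintro x ⟨s, hs⟩
      refine ⟨s - x, ?_⟩
      rw [smul_eq_mul, map_mul, aug_tt, one_mul]
      linear_combination hs
    · rintro x ⟨s, hs⟩
      refine ⟨s + ti * x, ?_⟩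
      rw [smul_eq_mul, map_mul, haugti, one_mul]
      linear_combination hs + x * tt_mul_ti
  rwa [smul_eq_mul, mul_one] at h

theorem one_sub_tt_ne_zero : (1 - tt : Lam) ≠ 0 := by
  intro h
  -- Evaluation at t = 2; any unit of ℚ other than 1 would do.
  have h1 := congrArg (LaurentPolynomial.eval₂ (Int.castRingHom ℚ) (Units.mk0 2 two_ne_zero)) h
  norm_num at h1

/-- The `Λ`-module structure for which `t` acts as a given automorphism. -/
abbrev lamModule {V : Type*} [AddCommGroup V] (τ : V ≃+ V) : Module Lam V :=
  let u : (AddMonoid.End V)ˣ :=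
    ⟨τ.toAddMonoidHom, τ.symm.toAddMonoidHom, AddMonoidHom.ext τ.apply_symm_apply,
      AddMonoidHom.ext τ.symm_apply_apply⟩
  Module.compHom V
    (AddMonoidAlgebra.lift ℤ (AddMonoid.End V) ℤ
      ((Units.coeHom _).comp (zpowersHom _ u))).toRingHom

theorem lamModule_tt_smul {V : Type*} [AddCommGroup V] (τ : V ≃+ V) (v : V) :
    (lamModule τ).toSMul.smul tt v = τ v := by
  let u : (AddMonoid.End V)ˣ :=
    ⟨τ.toAddMonoidHom, τ.symm.toAddMonoidHom, AddMonoidHom.ext τ.apply_symm_apply,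
      AddMonoidHom.ext τ.symm_apply_apply⟩
  change AddMonoidAlgebra.lift ℤ (AddMonoid.End V) ℤ
      ((Units.coeHom _).comp (zpowersHom _ u)) (AddMonoidAlgebra.single 1 1) v = τ v
  rw [AddMonoidAlgebra.lift_single, one_smul]
  change (u ^ (1 : ℤ)).val v = τ v
  rw [zpow_one]
  rfl

/-! ## Displacements of medial quandles -/

section Displacements

variable {Q : Type*} [Quandle Q]

theorem act'_mul_inv_mem_Dis (y z : Q) : Rack.act' y * (Rack.act' z)⁻¹ ∈ Dis Q :=
  Subgroup.subset_closure ⟨y, z, rfl⟩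

theorem act'_invAct (x y : Q) :
    Rack.act' (x ◃⁻¹ y) = (Rack.act' x)⁻¹ * Rack.act' y * Rack.act' x := by
  have h := Rack.ad_conj x (x ◃⁻¹ y)
  rw [Rack.act_invAct_eq] at h
  rw [h]
  group

theorem conj_mem_Dis (w : Q) {d : Equiv.Perm Q} (hd : d ∈ Dis Q) :
    Rack.act' w * d * (Rack.act' w)⁻¹ ∈ Dis Q := by
  induction hd using Subgroup.closure_induction with
  | mem d h =>
    obtain ⟨y, z, rfl⟩ := h
    have : Rack.act' w * (Rack.act' y * (Rack.act' z)⁻¹) * (Rack.act' w)⁻¹ =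
        Rack.act' (w ◃ y) * (Rack.act' (w ◃ z))⁻¹ := by
      rw [Rack.ad_conj, Rack.ad_conj]
      group
    rw [this]
    exact act'_mul_inv_mem_Dis _ _
  | one => simp
  | mul x y _ _ hx hy =>
    convert mul_mem hx hy using 1
    group
  | inv x _ hx =>
    convert inv_mem hx using 1
    group

theorem inv_conj_mem_Dis (w : Q) {d : Equiv.Perm Q} (hd : d ∈ Dis Q) :
    (Rack.act' w)⁻¹ * d * Rack.act' w ∈ Dis Q := by
  induction hd using Subgroup.closure_induction with
  | mem d h =>
    obtain ⟨y, z, rfl⟩ := h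
    have : (Rack.act' w)⁻¹ * (Rack.act' y * (Rack.act' z)⁻¹) * Rack.act' w =
        Rack.act' (w ◃⁻¹ y) * (Rack.act' (w ◃⁻¹ z))⁻¹ := by
      rw [act'_invAct, act'_invAct]
      group
    rw [this]
    exact act'_mul_inv_mem_Dis _ _
  | one => simp
  | mul x y _ _ hx hy =>
    convert mul_mem hx hy using 1
    group
  | inv x _ hx =>
    convert inv_mem hx using 1
    group

/-- Mediality as an identity of translations: expand β_{z ◃ y} and β_{z ◃ x} as conjugates and
cancel β_z on the left. -/
theorem Rack.IsAbelian.act'_swap (h : Rack.IsAbelian Q) (x y z : Q) :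
    Rack.act' y * (Rack.act' z)⁻¹ * Rack.act' x = Rack.act' x * (Rack.act' z)⁻¹ * Rack.act' y := by
  have key : Rack.act' (z ◃ y) * Rack.act' x = Rack.act' (z ◃ x) * Rack.act' y :=
    Equiv.ext fun w => h z y x w
  rw [Rack.ad_conj, Rack.ad_conj] at key
  simpa only [mul_assoc, mul_right_inj] using key

theorem Rack.IsAbelian.act'_inv_swap (h : Rack.IsAbelian Q) (x y z : Q) :
    (Rack.act' y)⁻¹ * Rack.act' z * (Rack.act' x)⁻¹ =
      (Rack.act' x)⁻¹ * Rack.act' z * (Rack.act' y)⁻¹ := by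
  have key := congrArg (·⁻¹) (h.act'_swap x y z)
  simpa only [mul_inv_rev, inv_inv, mul_assoc] using key.symm

/-- The displacement group of a medial quandle is commutative. -/
theorem Rack.IsAbelian.Dis_comm (h : Rack.IsAbelian Q) {d d' : Equiv.Perm Q} (hd : d ∈ Dis Q)
    (hd' : d' ∈ Dis Q) : d * d' = d' * d := by
  have key : ∀ x y z w : Q, Rack.act' x * (Rack.act' y)⁻¹ * (Rack.act' z * (Rack.act' w)⁻¹) =
      Rack.act' z * (Rack.act' w)⁻¹ * (Rack.act' x * (Rack.act' y)⁻¹) := fun x y z w =>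
    calc _ = Rack.act' x * (Rack.act' y)⁻¹ * Rack.act' z * (Rack.act' w)⁻¹ := by group
      _ = Rack.act' z * ((Rack.act' y)⁻¹ * Rack.act' x * (Rack.act' w)⁻¹) := by
        rw [h.act'_swap]; group
      _ = _ := by rw [h.act'_inv_swap]; group
  induction hd, hd' using Subgroup.closure_induction₂ with
  | mem d d' hd hd' =>
    obtain ⟨x, y, rfl⟩ := hd
    obtain ⟨z, w, rfl⟩ := hd'
    exact key x y z w
  | one_left => simp
  | one_right => simp
  | mul_left x y z _ _ _ h₁ h₂ => exact Commute.mul_left h₁ h₂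
  | mul_right y z x _ _ _ h₁ h₂ => exact Commute.mul_right h₁ h₂
  | inv_left x y _ _ h => exact Commute.inv_left h
  | inv_right x y _ _ h => exact Commute.inv_right h

/-- The displacement group of a medial quandle, as a `Λ`-module on which `t` acts as conjugation
by the translation `β_q`. -/
def DisMod (Q : Type*) [Quandle Q] (_h : Rack.IsAbelian Q) (_q : Q) : Type _ := Additive (Dis Q)

namespace DisMod

variable (h : Rack.IsAbelian Q) (q : Q)

instance : AddCommGroup (DisMod Q h q) :=
  letI : CommGroup (Dis Q) :=
    { (inferInstance : Group (Dis Q)) with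
      mul_comm := fun x y => Subtype.ext (h.Dis_comm x.2 y.2) }
  inferInstanceAs (AddCommGroup (Additive (Dis Q)))

variable {h q}

/-- An element of `Dis Q`, as an element of `DisMod`. -/
def of (d : Equiv.Perm Q) (hd : d ∈ Dis Q) : DisMod Q h q := Additive.ofMul ⟨d, hd⟩

/-- The displacement given by an element of `DisMod`. -/
def perm (v : DisMod Q h q) : Equiv.Perm Q := (Additive.toMul v : Dis Q).1

theorem perm_mem (v : DisMod Q h q) : v.perm ∈ Dis Q := (Additive.toMul v : Dis Q).2

theorem perm_of (d : Equiv.Perm Q) (hd : d ∈ Dis Q) : (of d hd : DisMod Q h q).perm = d := rfl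

theorem perm_injective : Function.Injective (perm : DisMod Q h q → Equiv.Perm Q) :=
  fun _ _ e => Subtype.ext e

theorem perm_zero : (0 : DisMod Q h q).perm = 1 := rfl

theorem perm_add (v w : DisMod Q h q) : (v + w).perm = v.perm * w.perm := rfl

theorem perm_neg (v : DisMod Q h q) : (-v).perm = v.perm⁻¹ := rfl

theorem perm_sub (v w : DisMod Q h q) : (v - w).perm = v.perm * w.perm⁻¹ := by
  rw [sub_eq_add_neg, perm_add, perm_neg]

/-- Conjugation by `β_q`. -/
def conj : DisMod Q h q ≃+ DisMod Q h q where
  toFun v := of (Rack.act' q * v.perm * (Rack.act' q)⁻¹) (conj_mem_Dis q v.perm_mem)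
  invFun v := of ((Rack.act' q)⁻¹ * v.perm * Rack.act' q) (inv_conj_mem_Dis q v.perm_mem)
  left_inv v := perm_injective (by simp only [perm_of]; group)
  right_inv v := perm_injective (by simp only [perm_of]; group)
  map_add' v w := perm_injective (by simp only [perm_of, perm_add]; group)

instance : Module Lam (DisMod Q h q) := lamModule conj

theorem perm_tt_smul (v : DisMod Q h q) :
    (tt • v).perm = Rack.act' q * v.perm * (Rack.act' q)⁻¹ :=
  congrArg perm (lamModule_tt_smul conj v)

/-- Conjugation by any translation is multiplication by `t`. -/
theorem perm_tt_smul' (v : DisMod Q h q) (x : Q) :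
    (tt • v).perm = Rack.act' x * v.perm * (Rack.act' x)⁻¹ := by
  -- Conjugation by β_x is conjugation by β_q followed by conjugation by the displacement β_x β_q⁻¹,
  -- which acts trivially on the commutative group `Dis Q`.
  have h1 := h.Dis_comm (conj_mem_Dis q v.perm_mem) (act'_mul_inv_mem_Dis x q)
  rw [perm_tt_smul, ← mul_right_cancel_iff (a := Rack.act' x * (Rack.act' q)⁻¹), h1]
  group

/-- The displacement `β_x β_q⁻¹`. -/
def rel (x : Q) : DisMod Q h q := of (Rack.act' x * (Rack.act' q)⁻¹) (act'_mul_inv_mem_Dis x q)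

theorem perm_rel (x : Q) : (rel x : DisMod Q h q).perm = Rack.act' x * (Rack.act' q)⁻¹ := rfl

/-- This makes x ↦ β_x β_q⁻¹ a quandle map to an affine quandle, so that a crossing relation in
MQ(L) becomes a relation of the Alexander module. In the proof t is conjugation by β_x in one term
and by β_q in the other, which makes the product collapse. -/
theorem rel_act (x y : Q) :
    (rel (x ◃ y) : DisMod Q h q) = (1 - tt) • rel x + tt • rel y := by
  apply perm_injective
  rw [sub_smul, one_smul, add_comm, perm_add, perm_sub, perm_tt_smul' _ x, perm_tt_smul]
  simp only [perm_rel, Rack.ad_conj]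
  group

theorem rel_invAct (x y : Q) :
    (rel (x ◃⁻¹ y) : DisMod Q h q) = (1 - ti) • rel x + ti • rel y := by
  have h1 := rel_act (h := h) (q := q) x (x ◃⁻¹ y)
  rw [Rack.act_invAct_eq] at h1
  rw [h1, smul_add, ti_smul_tt, smul_smul, mul_sub, mul_one, mul_comm ti tt, tt_mul_ti]
  module

end DisMod

end Displacements

/-! ## Translations of `Q(N, (m_i), (X_i))` -/

namespace PeripheralData

variable {M : Type*} [AddCommGroup M] [Module Lam M] {I : Type*} (P : PeripheralData M I)

/-- The element `n + X_i` of `Q_i`. -/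
def point (i : I) (n : P.N) : P.Carrier := ⟨i, Submodule.Quotient.mk n⟩

theorem exists_eq_point (z : P.Carrier) : ∃ n, z = P.point z.1 n := by
  obtain ⟨i, z⟩ := z
  obtain ⟨n, rfl⟩ := Submodule.Quotient.mk_surjective _ z
  exact ⟨n, rfl⟩

theorem point_eq_point_iff (i : I) (n n' : P.N) :
    P.point i n = P.point i n' ↔ (n - n' : M) ∈ P.X i := by
  refine Sigma.mk.inj_iff.trans ?_
  rw [heq_eq_eq, Submodule.Quotient.eq]
  exact and_iff_right rfl

/-- `N` acts on `Q(N, (m_i), (X_i))` by translations. -/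
instance : AddAction P.N P.Carrier where
  vadd n z := ⟨z.1, Submodule.Quotient.mk n + z.2⟩
  zero_vadd z := by
    change (⟨z.1, Submodule.Quotient.mk 0 + z.2⟩ : P.Carrier) = z
    rw [Submodule.Quotient.mk_zero, zero_add]
    rfl
  add_vadd n n' z := by
    change (⟨z.1, Submodule.Quotient.mk (n + n') + z.2⟩ : P.Carrier) =
      ⟨z.1, Submodule.Quotient.mk n + (Submodule.Quotient.mk n' + z.2)⟩
    rw [Submodule.Quotient.mk_add, add_assoc]

theorem vadd_point (n n' : P.N) (i : I) : n +ᵥ P.point i n' = P.point i (n + n') := rfl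

theorem vadd_eq_self_iff (n : P.N) (z : P.Carrier) : n +ᵥ z = z ↔ (n : M) ∈ P.X z.1 := by
  obtain ⟨k, hk⟩ := P.exists_eq_point z
  rw [hk, vadd_point, point_eq_point_iff]
  simp [point]

theorem exists_vadd_eq {z z' : P.Carrier} (h : z.1 = z'.1) : ∃ n : P.N, n +ᵥ z = z' := by
  obtain ⟨k, hk⟩ := P.exists_eq_point z
  obtain ⟨k', hk'⟩ := P.exists_eq_point z'
  exact ⟨k' - k, by rw [hk, hk', vadd_point, h, sub_add_cancel]⟩

/-- The natural map, with values in the module `M`. -/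
def nat (z : P.Carrier) : M := P.m z.1 + P.oneSub z.1 z.2

theorem nat_point (i : I) (n : P.N) : P.nat (P.point i n) = P.m i + (1 - tt) • (n : M) := rfl

theorem nat_vadd (n : P.N) (z : P.Carrier) : P.nat (n +ᵥ z) = (1 - tt) • (n : M) + P.nat z := by
  obtain ⟨k, hk⟩ := P.exists_eq_point z
  rw [hk, vadd_point, nat_point, nat_point, Submodule.coe_add, smul_add]
  abel

theorem nat_sub_mem (y z : P.Carrier) : P.nat y - P.nat z ∈ P.N := by
  obtain ⟨k, hk⟩ := P.exists_eq_point y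
  obtain ⟨l, hl⟩ := P.exists_eq_point z
  rw [hk, hl, nat_point, nat_point, add_sub_add_comm]
  exact P.N.add_mem (P.m_sub_mem _ _)
    (P.N.sub_mem (P.N.smul_mem _ k.2) (P.N.smul_mem _ l.2))

/-- The difference of the values of the natural map, as an element of `N`. -/
def natSub (y z : P.Carrier) : P.N := ⟨P.nat y - P.nat z, P.nat_sub_mem y z⟩

/-- For z ∈ Q_j, m_i - m_j + tz + (1-t)y is z plus the difference of m_i + (1-t)y and m_j + (1-t)z.
Thus y acts only through its value in M. -/
theorem act_eq_vadd (y z : P.Carrier) : y ◃ z = P.natSub y z +ᵥ z := by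
  obtain ⟨i, y⟩ := y
  obtain ⟨j, z⟩ := z
  obtain ⟨y, rfl⟩ := Submodule.Quotient.mk_surjective _ y
  obtain ⟨z, rfl⟩ := Submodule.Quotient.mk_surjective _ z
  change P.point j (P.diff i j + tt • z + (1 - tt) • y) =
    P.point j (P.natSub (P.point i y) (P.point j z) + z)
  congr 1
  apply Subtype.ext
  simp only [diff, natSub, nat_point, Submodule.coe_add, Submodule.coe_smul]
  module

theorem act_vadd (y z : P.Carrier) (n : P.N) : y ◃ (n +ᵥ z) = tt • n +ᵥ (y ◃ z) := by
  rw [act_eq_vadd, act_eq_vadd, vadd_vadd, vadd_vadd]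
  congr 1
  apply Subtype.ext
  simp only [natSub, nat_vadd, Submodule.coe_add, Submodule.coe_smul]
  module

/-- An elementary displacement is a translation. -/
theorem act_invAct_eq_vadd (y z x : P.Carrier) : y ◃ (z ◃⁻¹ x) = P.natSub y z +ᵥ x := by
  obtain ⟨w, rfl⟩ : ∃ w, x = z ◃ w := ⟨z ◃⁻¹ x, (Rack.act_invAct_eq _ _).symm⟩
  rw [Rack.invAct_act_eq, act_eq_vadd, act_eq_vadd, vadd_vadd]
  congr 1
  apply Subtype.ext
  simp only [natSub, Submodule.coe_add]
  abel

/-! ## Quasi-affine quandles -/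

end PeripheralData

theorem isAbelian_affine (M : Type*) [AddCommGroup M] [Module Lam M] :
    Rack.IsAbelian (Affine M) := by
  intro (x : M) (y : M) (z : M) (w : M)
  change tt • (tt • w + (1 - tt) • z : M) + (1 - tt) • (tt • y + (1 - tt) • x : M) =
    tt • (tt • w + (1 - tt) • y : M) + (1 - tt) • (tt • z + (1 - tt) • x : M)
  module

theorem isAbelian_quandleImage {Q R : Type*} [Quandle Q] [Quandle R] (f : Q →◃ R)
    (h : Rack.IsAbelian R) : Rack.IsAbelian (QuandleImage f) :=
  fun x y z w => Subtype.ext (h x.1 y.1 z.1 w.1)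

/-- An element of the affine quandle of `M`, as an element of `M`. -/
def Affine.val {M : Type*} (x : Affine M) : M := x

/-- Displacements of a subquandle of an affine quandle are restrictions of translations of the
module, and a translation with a fixed point is translation by 0. -/
theorem affine_semiregular {Q M : Type*} [Quandle Q] [AddCommGroup M] [Module Lam M]
    (f : Q →◃ Affine M) : Semiregular (QuandleImage f) := by
  have key : ∀ d ∈ Dis (QuandleImage f), ∃ n : M, ∀ x, (d x).1.val = n + x.1.val := by
    intro d hd
    induction hd using Subgroup.closure_induction with
    | mem d h =>
      obtain ⟨y, z, rfl⟩ := h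
      refine ⟨(1 - tt) • (y.1.val - z.1.val), fun x => ?_⟩
      change tt • (ti • x.1.val + (1 - ti) • z.1.val) + (1 - tt) • y.1.val = _
      rw [smul_add, tt_smul_ti, smul_smul, mul_sub, tt_mul_ti]
      module
    | one => exact ⟨0, fun x => (zero_add x.1.val).symm⟩
    | mul x y _ _ hx hy =>
      obtain ⟨n, hn⟩ := hx
      obtain ⟨k, hk⟩ := hy
      refine ⟨n + k, fun z => ?_⟩
      rw [Equiv.Perm.mul_apply, hn, hk, add_assoc]
    | inv x _ hx =>
      obtain ⟨n, hn⟩ := hx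
      refine ⟨-n, fun z => ?_⟩
      have h := hn (x⁻¹ z)
      rw [← Equiv.Perm.mul_apply, mul_inv_cancel, Equiv.Perm.one_apply] at h
      rw [h, neg_add_cancel_left]
  rintro d hd ⟨x, hx⟩
  obtain ⟨n, hn⟩ := key d hd
  have h0 : n = 0 := by
    have h := hn x
    rw [hx] at h
    exact right_eq_add.1 h
  refine Equiv.ext fun z => Subtype.ext ?_
  exact (hn z).trans (by rw [h0]; exact zero_add z.1.val)

/-! ### Quandle maps from Q(N, (m_i), (X_i)) to semiregular quandles. -/

namespace PeripheralData

variable {M : Type*} [AddCommGroup M] [Module Lam M] {I : Type*} (P : PeripheralData M I)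

/-- The elements of `N` whose translations are carried to displacements by a quandle map. -/
def displacing {Q : Type*} [Quandle Q] (g : P.Carrier →◃ Q) : AddSubgroup P.N where
  carrier := {n | ∃ d ∈ Dis Q, ∀ z, g (n +ᵥ z) = d (g z)}
  zero_mem' := ⟨1, one_mem _, fun z => by rw [zero_vadd]; rfl⟩
  add_mem' := by
    rintro n n' ⟨d, hd, h⟩ ⟨d', hd', h'⟩
    exact ⟨d * d', mul_mem hd hd', fun z => by rw [add_vadd, h, h']; rfl⟩
  neg_mem' := by
    rintro n ⟨d, hd, h⟩
    refine ⟨d⁻¹, inv_mem hd, fun z => ?_⟩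
    rw [eq_comm, Equiv.Perm.inv_eq_iff_eq, ← h, vadd_vadd, add_neg_cancel, zero_vadd]

theorem natSub_mem_displacing {Q : Type*} [Quandle Q] (g : P.Carrier →◃ Q) (y z : P.Carrier) :
    P.natSub y z ∈ P.displacing g := by
  refine ⟨_, act'_mul_inv_mem_Dis (g y) (g z), fun x => ?_⟩
  rw [← act_invAct_eq_vadd, ShelfHom.map_act, ShelfHom.map_invAct]
  rfl

/-- Both (1-t)n and m_i - m_j are differences of values of the natural map. Once (1-t)N is included,
closure under Λ is automatic: tx = x - (1-t)x and t⁻¹x = x + (1-t)t⁻¹x. -/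
theorem displacing_eq_top [Nonempty I] {Q : Type*} [Quandle Q] (g : P.Carrier →◃ Q)
    (hN : ∀ x : P.N, ∃ s ∈ Submodule.span Lam (Set.range fun p : I × I => P.diff p.1 p.2),
      ∃ n : P.N, x = s + (1 - tt : Lam) • n) (x : P.N) : x ∈ P.displacing g := by
  have h1 : ∀ n : P.N, (1 - tt : Lam) • n ∈ P.displacing g := by
    intro n
    obtain ⟨i⟩ := ‹Nonempty I›
    convert P.natSub_mem_displacing g (P.point i n) (P.point i 0)
    apply Subtype.ext
    simp [natSub, nat_point]
  let S : Submodule Lam P.N :=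
    { P.displacing g with
      smul_mem' := fun r x hx => (P.displacing g).lam_smul_mem
        (fun x hx => by
          have h := sub_mem hx (h1 x)
          have h2 : x - (1 - tt : Lam) • x = tt • x := by module
          rwa [h2] at h)
        (fun x hx => by
          have h := add_mem hx (h1 (ti • x))
          have h2 : x + (1 - tt : Lam) • ti • x = ti • x := by
            nth_rw 1 [← tt_smul_ti x]
            module
          rwa [h2] at h) r hx }
  obtain ⟨s, hs, n, rfl⟩ := hN x
  refine add_mem ((Submodule.span_le (p := S)).2 ?_ hs) (h1 n)
  rintro _ ⟨⟨i, j⟩, rfl⟩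
  change P.diff i j ∈ P.displacing g
  convert P.natSub_mem_displacing g (P.point i 0) (P.point j 0)
  apply Subtype.ext
  simp [natSub, nat_point, diff]

/-- A quandle map to a semiregular quandle identifies points of `Q(N, (m_i), (X_i))` with the
same image in `M`. -/
theorem eq_of_nat_eq {Q : Type*} [Quandle Q] (hQ : Semiregular Q) (g : P.Carrier →◃ Q)
    (hm : ∀ i j, ∀ n : P.N, P.m i - P.m j = (1 - tt : Lam) • (n : M) → i = j)
    (hN : ∀ x : P.N, ∃ s ∈ Submodule.span Lam (Set.range fun p : I × I => P.diff p.1 p.2),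
      ∃ n : P.N, x = s + (1 - tt : Lam) • n)
    (hX : ∀ x ∈ P.N, (1 - tt : Lam) • x = 0 → x ∈ ⨆ i, P.X i)
    {x y : P.Carrier} (hxy : P.nat x = P.nat y) : g x = g y := by
  have : Nonempty I := ⟨x.1⟩
  -- Translation by an element of X_i fixes Q_i, so the displacement it induces has a fixed point
  -- and is trivial on all pieces, not only on Q_i.
  have hperiod : ∀ n ∈ ⨆ i, P.X i, ∃ h : n ∈ P.N, ∀ z, g ((⟨n, h⟩ : P.N) +ᵥ z) = g z := by
    intro n hn
    induction hn using Submodule.iSup_induction' with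
    | mem i n hn =>
      refine ⟨P.X_le i hn, fun z => ?_⟩
      obtain ⟨d, hd, h⟩ := P.displacing_eq_top g hN ⟨n, P.X_le i hn⟩
      have h1 := hQ d hd ⟨g (P.point i 0), by
        rw [← h, (P.vadd_eq_self_iff _ _).2]
        exact hn⟩
      rw [h, h1]
      rfl
    | zero => exact ⟨zero_mem _, fun z => congrArg g (zero_vadd P.N z)⟩
    | add n n' _ _ h h' =>
      obtain ⟨hn, h⟩ := h
      obtain ⟨hn', h'⟩ := h'
      refine ⟨add_mem hn hn', fun z => ?_⟩
      exact (congrArg g (add_vadd (⟨n, hn⟩ : P.N) ⟨n', hn'⟩ z)).trans ((h _).trans (h' z))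
  obtain ⟨k, hk⟩ := P.exists_eq_point x
  obtain ⟨l, hl⟩ := P.exists_eq_point y
  have hij : x.1 = y.1 := by
    refine hm _ _ (l - k) ?_
    rw [hk, hl, nat_point, nat_point] at hxy
    rw [Submodule.coe_sub, smul_sub, sub_eq_sub_iff_add_eq_add, hxy, add_comm]
  -- Two points of one piece with the same image in M differ by some n with (1-t)n = 0, that is, by
  -- a sum of elements of the X_i.
  obtain ⟨n, rfl⟩ := P.exists_vadd_eq hij.symm
  rw [nat_vadd, add_eq_right] at hxy
  obtain ⟨_, h⟩ := hperiod n (hX n n.2 hxy)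
  exact h y

end PeripheralData

namespace LinkDiagram

variable {μ : ℕ} (D : LinkDiagram μ)

/-! ## Arcs of one component -/

theorem arcOf_over (p : D.Passage) (h : (D.next p).2 = true) :
    D.arcOf (.inl (D.next p)) = D.arcOf (.inl p) :=
  (Quot.sound (Joined.over p h)).symm

theorem arcOf_next_symm_over (c : D.Crossing) :
    D.arcOf (.inl (D.next.symm (c, true))) = D.arcOf (.inl (c, true)) := by
  have h := D.arcOf_over (D.next.symm (c, true)) (by simp)
  rw [Equiv.apply_symm_apply] at h
  exact h.symm

theorem exists_iterate_next {p q : D.Passage} (h : D.comp p = D.comp q) :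
    ∃ k : ℕ, D.next^[k] p = q := by
  obtain ⟨k, _, hk⟩ := ((D.comp_eq_iff p q).1 h).exists_pow_eq'
  exact ⟨k, by rw [← hk, ← Equiv.Perm.iterate_eq_pow]⟩

/-- Induction along a component. -/
theorem arc_induction {C : D.Arc → Prop}
    (hC : ∀ p, C (D.arcOf (.inl p)) → C (D.arcOf (.inl (D.next p)))) {b b' : D.Arc}
    (h : D.κ b = D.κ b') (hb : C b) : C b' := by
  induction b using Quot.ind with | mk s => ?_
  induction b' using Quot.ind with | mk s' => ?_
  rcases s with p | i <;> rcases s' with q | j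
  · obtain ⟨k, rfl⟩ := D.exists_iterate_next h
    clear h
    induction k with
    | zero => exact hb
    | succ k ih =>
      rw [Function.iterate_succ_apply']
      exact hC _ ih
  · exact (j.2 p h).elim
  · exact (i.2 q h.symm).elim
  · obtain rfl : i = j := Subtype.ext h
    exact hb

/-! ## Transport along the underpasses -/

/-- The class of an arc in the Alexander module. -/
abbrev arc (b : D.Arc) : D.AlexMod := D.sig (D.e b)

/-- The element `w(c) (a(c) - b₁(c))` at the underpass of `c`, and `0` at an overpass. -/
def transport (p : D.Passage) : D.AlexMod :=
  if p.2 then 0 else (D.writhe p.1 : ℤ) • (D.arc (D.a p.1) - D.arc (D.b₁ p.1))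

theorem phi_transport (p : D.Passage) : D.phi (D.transport p) = 0 := by
  unfold transport
  split_ifs
  · exact map_zero _
  · rw [map_zsmul, map_sub, phi_sig_e, phi_sig_e, sub_self, smul_zero]

/-- The crossing relation reads (1-t)(a - b₁) = b₂ - b₁; the sign w(c) turns the right side into
outgoing minus incoming arc. Sums along a component therefore telescope. -/
theorem one_sub_smul_transport (p : D.Passage) :
    (1 - tt) • D.transport p =
      D.arc (D.arcOf (.inl p)) - D.arc (D.arcOf (.inl (D.next.symm p))) := by
  obtain ⟨c, _ | _⟩ := p
  · change _ = D.arc (D.outArc c) - D.arc (D.inArc c)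
    rw [transport, if_neg (by simp), smul_comm, smul_sub (1 - tt), sig_crossing]
    rcases Int.units_eq_one_or (D.writhe c) with h | h <;> simp only [b₁, b₂, h] <;> simp
    · module
    · module
  · rw [arcOf_next_symm_over, transport, if_pos rfl, smul_zero, sub_self]

theorem sum_transport (i : Fin μ) :
    ∑ p with D.comp p = i, D.transport p = D.longitude i := by
  rw [Finset.sum_filter, Fintype.sum_prod_type, longitude, halfSum, ← Finset.sum_sub_distrib,
    map_sum, underCrossings, Finset.sum_filter]
  refine Finset.sum_congr rfl fun c _ => ?_
  rw [Fintype.sum_bool, D.κ_b₁]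
  simp only [transport, if_true, ite_self, Bool.false_eq_true, if_false, zero_add, smul_sub,
    map_sub, map_zsmul]

theorem arc_sub_arc (b b' : D.Arc) (h : D.κ b = D.κ b') :
    ∃ n : D.AlexMod, D.phi n = 0 ∧ D.arc b' = D.arc b + (1 - tt) • n := by
  refine D.arc_induction (C := fun b' => ∃ n : D.AlexMod, D.phi n = 0 ∧
    D.arc b' = D.arc b + (1 - tt) • n) ?_ h ⟨0, map_zero _, by rw [smul_zero, add_zero]⟩
  rintro p ⟨n, hn, h⟩
  refine ⟨n + D.transport (D.next p), by rw [map_add, hn, phi_transport, add_zero], ?_⟩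
  rw [smul_add, one_sub_smul_transport, Equiv.symm_apply_apply, ← add_assoc, ← h]
  abel

/-! ## The kernel of `φ_τ` -/

/-- Induction over the Alexander module. -/
theorem alexMod_induction {C : D.AlexMod → Prop} (hz : C 0) (hadd : ∀ x y, C x → C y → C (x + y))
    (hs : ∀ (r : Lam) (b : D.Arc), C (r • D.arc b)) (x : D.AlexMod) : C x := by
  obtain ⟨x, rfl⟩ := Submodule.Quotient.mk_surjective _ x
  change C (D.sig x)
  induction x using Finsupp.induction_linear with
  | zero => rwa [map_zero]
  | add x y hx hy => rw [map_add]; exact hadd _ _ hx hy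
  | single b r =>
    have h := hs r b
    rwa [arc, ← map_smul, Finsupp.smul_single, smul_eq_mul, mul_one] at h

/-- A choice of one arc on each component generates the Alexander module modulo `1 - t`. -/
theorem exists_eq_sum_add (m : Fin μ → D.AlexMod)
    (hm : ∀ b : D.Arc, ∃ y, D.arc b = m (D.κ b) + (1 - tt) • y) (x : D.AlexMod) :
    ∃ (r : Fin μ → Lam) (y : D.AlexMod), x = ∑ i, r i • m i + (1 - tt) • y := by
  induction x using D.alexMod_induction with
  | hz => exact ⟨0, 0, by simp⟩
  | hadd x y hx hy =>
    obtain ⟨r, z, rfl⟩ := hx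
    obtain ⟨r', z', rfl⟩ := hy
    refine ⟨r + r', z + z', ?_⟩
    simp only [Pi.add_apply, add_smul, Finset.sum_add_distrib, smul_add]
    abel
  | hs r b =>
    obtain ⟨y, hy⟩ := hm b
    refine ⟨Pi.single (D.κ b) r, r • y, ?_⟩
    rw [Finset.sum_eq_single (D.κ b), Pi.single_eq_same, hy, smul_add, smul_comm]
    · intro j _ hj
      rw [Pi.single_eq_of_ne hj, zero_smul]
    · simp

theorem eq_zero_of_phi_one_sub {y : D.AlexMod} (h : D.phi ((1 - tt) • y) = 0) : D.phi y = 0 := by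
  rw [map_smul, smul_eq_mul] at h
  exact (mul_eq_zero.1 h).resolve_left one_sub_tt_ne_zero

section PhiTau

variable [NeZero μ]

theorem phiTau_arc (b : D.Arc) : D.phiTau (D.arc b) = arcValue (D.κ b) := by
  change Finsupp.linearCombination Lam (fun b => (arcValue (D.κ b) : AMu μ)) (D.e b) = _
  simp

theorem phiTau_fst (x : D.AlexMod) : (D.phiTau x).1 = D.phi x := by
  induction x using D.alexMod_induction with
  | hz => simp
  | hadd x y hx hy => rw [map_add, map_add, Prod.fst_add, hx, hy]
  | hs r b => rw [map_smul, map_smul, Prod.smul_fst, phiTau_arc, phi_sig_e]; rfl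

theorem one_sub_smul_trivZ (n : TrivZ) : (1 - tt) • n = 0 := by
  rw [sub_smul, one_smul, tt_smul_trivZ, sub_self]

/-- Λ acts on the ℤ-coordinates through the augmentation, so these coordinates see only the values
of the coefficients at t = 1. -/
theorem aug_arcValue {κ : Type*} [Fintype κ] (f : κ → Fin μ) (r : κ → Lam)
    (j : {j : Fin μ // j ≠ 0}) :
    (∑ i, r i • (arcValue (f i) : AMu μ)).2 j = (∑ i, if j.1 = f i then aug (r i) else 0 : ℤ) := by
  rw [Prod.snd_sum, Finset.sum_apply]
  refine Finset.sum_congr rfl fun i _ => ?_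
  simp only [arcValue, Prod.smul_snd, Pi.smul_apply]
  split_ifs
  · change aug (r i) • (1 : ℤ) = _
    simp
  · exact smul_zero _

/-- The kernel of `φ_τ` is `(1 - t) ker φ`. -/
theorem exists_of_phiTau_eq_zero {x : D.AlexMod} (hx : D.phiTau x = 0) :
    ∃ y, D.phi y = 0 ∧ x = (1 - tt) • y := by
  choose c hc using D.κ_surjective
  obtain ⟨r, y, rfl⟩ := D.exists_eq_sum_add (fun i => D.arc (c i)) (fun b => by
    obtain ⟨n, _, h⟩ := D.arc_sub_arc (c (D.κ b)) b (hc _)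
    exact ⟨n, h⟩) x
  have hφ : ∑ i, r i + (1 - tt) * D.phi y = 0 := by
    rw [← phiTau_fst, ← smul_eq_mul, ← Prod.smul_fst, ← map_smul]
    have h := congrArg Prod.fst hx
    rw [map_add, map_sum] at h
    simpa [phiTau_arc, arcValue, Prod.fst_sum] using h
  have h1 : ∀ j, j ≠ 0 → aug (r j) = 0 := by
    intro j hj
    have h := congrFun (congrArg Prod.snd hx) ⟨j, hj⟩
    rw [map_add, Prod.snd_add, Pi.add_apply, map_smul, Prod.smul_snd, Pi.smul_apply,
      one_sub_smul_trivZ, add_zero, map_sum] at h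
    simp only [map_smul, phiTau_arc, hc] at h
    rw [aug_arcValue] at h
    exact (by simp : aug (r j) = ∑ i, if j = i then aug (r i) else 0).trans h
  -- The first component has no coordinate of its own; its coefficient is caught by augmenting φ(x)
  -- = 0.
  have h2 : ∀ j, aug (r j) = 0 := by
    intro j
    by_cases hj : j = 0
    · have h := congrArg aug hφ
      rw [map_add, map_sum, map_mul, map_sub, map_one, aug_tt, sub_self, zero_mul, add_zero,
        map_zero, Finset.sum_eq_single 0 (fun i _ hi => h1 i hi) (by simp)] at h
      rw [hj, h]
    · exact h1 j hj
  have h3 : ∀ j, ∃ s, r j = (1 - tt) * s := fun j => by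
    obtain ⟨s, hs⟩ := exists_eq_aug_add (r j)
    exact ⟨s, by simpa [h2 j] using hs⟩
  choose s hs using h3
  have h4 : ∑ i, r i • D.arc (c i) + (1 - tt) • y =
      (1 - tt) • (∑ i, s i • D.arc (c i) + y) := by
    simp only [hs, mul_smul, smul_add, Finset.smul_sum]
  refine ⟨_, D.eq_zero_of_phi_one_sub ?_, h4⟩
  rw [← h4, ← phiTau_fst, hx]
  rfl

theorem IsMeridian.phiTau_eq {i : Fin μ} {x : D.AlexMod} (h : D.IsMeridian i x) :
    D.phiTau x = arcValue i := by
  obtain ⟨b, rfl, hb⟩ := h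
  rw [hb, phiTau_arc]

theorem IsMeridian.exists_eq_add {i : Fin μ} {x : D.AlexMod} (h : D.IsMeridian i x) {b : D.Arc}
    (hb : D.κ b = i) : ∃ y, D.phi y = 0 ∧ D.arc b = x + (1 - tt) • y := by
  obtain ⟨y, hy, h⟩ := D.exists_of_phiTau_eq_zero (x := D.arc b - x)
    (by rw [map_sub, phiTau_arc, h.phiTau_eq, hb, sub_self])
  exact ⟨y, hy, by rw [← h]; abel⟩

theorem arcValue_injective : Function.Injective (arcValue : Fin μ → AMu μ) := by
  intro i j h
  have key : ∀ k : Fin μ, k ≠ 0 → (k = i ↔ k = j) := by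
    intro k hk
    have h1 : (if k = i then TrivZ.one else 0) = if k = j then TrivZ.one else 0 :=
      congrFun (congrArg Prod.snd h) ⟨k, hk⟩
    have h2 : TrivZ.one ≠ 0 := one_ne_zero (α := ℤ)
    split_ifs at h1 <;> simp_all
  by_cases hi : i = 0
  · by_cases hj : j = 0
    · rw [hi, hj]
    · exact ((key j hj).2 rfl).symm
  · exact (key i hi).1 rfl

variable (m : Fin μ → D.AlexMod) (hm : ∀ i, D.IsMeridian i (m i))

/-- Multiplication by 1-t kills the ℤ-coordinates of φ_τ, and these alone determine the component.
-/
theorem eq_of_meridian_sub {i j : Fin μ} {n : D.AlexMod}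
    (h : (D.peripheral m hm).m i - (D.peripheral m hm).m j = (1 - tt) • n) : i = j := by
  apply arcValue_injective
  have h1 := congrArg D.phiTau h
  change D.phiTau (m i - m j) = _ at h1
  rw [map_sub, (hm i).phiTau_eq, (hm j).phiTau_eq, map_smul] at h1
  refine Prod.ext rfl (funext fun k => ?_)
  have h2 := congrFun (congrArg Prod.snd h1) k
  rw [Prod.smul_snd, Pi.smul_apply, one_sub_smul_trivZ, Prod.snd_sub, Pi.sub_apply,
    sub_eq_zero] at h2
  exact h2

/-- The differences of meridians generate `N` modulo `(1 - t) N`. -/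
theorem exists_mem_span_diff (x : (D.peripheral m hm).N) :
    ∃ s ∈ Submodule.span Lam
        (Set.range fun p : Fin μ × Fin μ => (D.peripheral m hm).diff p.1 p.2),
      ∃ n : (D.peripheral m hm).N, x = s + (1 - tt : Lam) • n := by
  obtain ⟨x, hx⟩ := x
  obtain ⟨r, y, h⟩ := D.exists_eq_sum_add m (fun b => by
    obtain ⟨y, _, h⟩ := (hm (D.κ b)).exists_eq_add D rfl
    exact ⟨y, h⟩) x
  have hφ : D.phi x = 0 := hx
  have h1 : ∑ i, r i + (1 - tt) * D.phi y = 0 := by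
    rw [← hφ, h]
    simp [(hm _).phi_eq]
  -- Since φ(m_0) = 1, subtracting φ(y) m_0 brings y into N. The correction matches the terms in m_0
  -- because the r_i sum to -(1-t)φ(y).
  refine ⟨∑ i, r i • (D.peripheral m hm).diff i 0,
    Submodule.sum_mem _ fun i _ => Submodule.smul_mem _ _ (Submodule.subset_span ⟨(i, 0), rfl⟩),
    ⟨y - D.phi y • m 0, ?_⟩, ?_⟩
  · change D.phi _ = 0
    rw [map_sub, map_smul, (hm 0).phi_eq, smul_eq_mul, mul_one, sub_self]
  · apply Subtype.ext
    rw [Submodule.coe_add, Submodule.coe_smul, Submodule.coe_sum]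
    change x = ∑ i, r i • (m i - m 0) + (1 - tt) • (y - D.phi y • m 0)
    simp only [smul_sub, Finset.sum_sub_distrib, ← Finset.sum_smul]
    rw [eq_neg_of_add_eq_zero_left h1, h, neg_smul, mul_smul]
    abel

end PhiTau

end LinkDiagram

namespace LinkDiagram

variable {μ : ℕ} (D : LinkDiagram μ)

/-! ## The ends of an arc -/

/-- `FirstUnder σ p q`: following `σ` from `p` (inclusive), the first underpass is `q`. -/
inductive FirstUnder {D : LinkDiagram μ} (σ : Equiv.Perm D.Passage) :
    D.Passage → D.Passage → Prop
  | here (p) (h : p.2 = false) : FirstUnder σ p p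
  | step (p q) (h : p.2 = true) (h' : FirstUnder σ (σ p) q) : FirstUnder σ p q

theorem firstUnder_over {σ : Equiv.Perm D.Passage} {p q : D.Passage} (h : p.2 = true) :
    FirstUnder σ p q ↔ FirstUnder σ (σ p) q := by
  refine ⟨fun h' => ?_, FirstUnder.step p q h⟩
  cases h' with
  | here _ h' => simp [h] at h'
  | step _ _ _ h' => exact h'

theorem firstUnder_under {σ : Equiv.Perm D.Passage} {p q : D.Passage} (h : p.2 = false) :
    FirstUnder σ p q ↔ q = p := by
  refine ⟨fun h' => ?_, ?_⟩
  · cases h' with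
    | here _ h' => rfl
    | step _ _ h' _ => simp [h] at h'
  · rintro rfl
    exact FirstUnder.here _ h

/-- The underpasses at which an arc ends. -/
def arcEnd : D.Arc → Set D.Passage :=
  Quot.lift (Sum.elim (fun p => {q | FirstUnder D.next (D.next p) q}) fun _ => ∅) (by
    rintro _ _ ⟨p, h⟩
    exact Set.ext fun q => D.firstUnder_over h)

/-- The underpasses at which an arc starts. -/
def arcStart : D.Arc → Set D.Passage :=
  Quot.lift (Sum.elim (fun p => {q | FirstUnder D.next.symm p q}) fun _ => ∅) (by
    rintro _ _ ⟨p, h⟩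
    refine Set.ext fun q => ((D.firstUnder_over h).trans ?_).symm
    rw [Equiv.symm_apply_apply]
    rfl)

/-- The first underpass met after an arc is constant on `Joined` classes, so the incoming arc
remembers its crossing. -/
theorem inArc_injective : Function.Injective D.inArc := by
  have key : ∀ c, D.arcEnd (D.inArc c) = {(c, false)} := fun c => by
    change {q | FirstUnder D.next (D.next (D.next.symm (c, false))) q} = _
    rw [Equiv.apply_symm_apply]
    exact Set.ext fun q => D.firstUnder_under rfl
  intro c c' h
  have h1 := congrArg D.arcEnd h
  rw [key, key, Set.singleton_eq_singleton_iff] at h1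
  exact congrArg Prod.fst h1

theorem outArc_injective : Function.Injective D.outArc := by
  have key : ∀ c, D.arcStart (D.outArc c) = {(c, false)} := fun c =>
    Set.ext fun q => D.firstUnder_under rfl
  intro c c' h
  have h1 := congrArg D.arcStart h
  rw [key, key, Set.singleton_eq_singleton_iff] at h1
  exact congrArg Prod.fst h1

/-! ## The kernel of `1 - t` -/

open Classical in
/-- A flow on the arcs, with value `k c` at the underpass of `c`, is constant on components. -/
theorem exists_eq_comp_of_flow (k : D.Crossing → ℤ)
    (hk : ∀ f : D.Arc → ℤ, ∑ c, k c * (f (D.inArc c) - f (D.outArc c)) = 0) :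
    ∃ K : Fin μ → ℤ, ∀ c, k c = K (D.κ (D.b₁ c)) := by
  -- H(b) is the value of k at the underpass where b starts, and 0 if b starts at none.
  let H : D.Arc → ℤ := fun b => ∑ c, if D.outArc c = b then k c else 0
  have hout : ∀ c, H (D.outArc c) = k c := fun c => by
    simp [H, D.outArc_injective.eq_iff]
  have hin : ∀ c, H (D.inArc c) = k c := fun c => by
    -- Testing the flow on the indicator of one arc says that inflow equals outflow there.
    have h := hk fun b => if b = D.inArc c then 1 else 0
    simp only [mul_sub, Finset.sum_sub_distrib, D.inArc_injective.eq_iff, mul_ite, mul_one,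
      mul_zero, Finset.sum_ite_eq', Finset.mem_univ, if_true, sub_eq_zero] at h
    exact h.symm
  choose b hb using D.κ_surjective
  refine ⟨fun i => H (b i), fun c => ?_⟩
  -- H does not change at an overpass, where the arc continues, nor at an underpass, where both arcs
  -- carry k; so it is constant along the component.
  refine (D.arc_induction (C := fun b => H b = k c) ?_ (b := D.outArc c) ?_ (hout c)).symm
  · intro p hp
    rw [← hp]
    obtain ⟨q, rfl⟩ := D.next.symm.surjective p
    rw [Equiv.apply_symm_apply]
    obtain ⟨c, _ | _⟩ := q
    · exact (hout c).trans (hin c).symm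
    · rw [arcOf_next_symm_over]
  · rw [hb, κ_outArc, κ_b₁]

theorem rho_apply (z : D.Crossing →₀ Lam) :
    D.rho z = ∑ c, z c • ((1 - tt) • D.e (D.a c) + tt • D.e (D.b₁ c) - D.e (D.b₂ c)) :=
  Finsupp.sum_fintype _ _ fun _ => zero_smul _ _

/-- The kernel of `1 - t` is generated by the longitudes. -/
theorem mem_iSup_longitude {x : D.AlexMod} (hx : (1 - tt) • x = 0) :
    x ∈ ⨆ i, Submodule.span Lam {D.longitude i} := by
  obtain ⟨y, rfl⟩ := Submodule.Quotient.mk_surjective _ x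
  obtain ⟨z, hz⟩ := (Submodule.Quotient.mk_eq_zero _).1 hx
  -- Setting t = 1 in ρ(z) = (1-t)y leaves ∑ aug(z_c)(b₁(c) - b₂(c)) = 0, so w(c) aug(z_c) is a
  -- flow.
  obtain ⟨K, hK⟩ := D.exists_eq_comp_of_flow (fun c => D.writhe c * aug (z c)) (fun f => by
    let F : D.Arc → TrivZ := f
    have h := congrArg (Finsupp.linearCombination Lam F) hz
    rw [map_smul, one_sub_smul_trivZ, rho_apply, map_sum] at h
    refine Eq.trans (Finset.sum_congr rfl fun c _ => ?_) h
    simp only [map_smul, map_sub, map_add, one_sub_smul_trivZ, zero_add,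
      Finsupp.linearCombination_single, one_smul, tt_smul_trivZ]
    change _ = aug (z c) * (f (D.b₁ c) - f (D.b₂ c))
    rcases Int.units_eq_one_or (D.writhe c) with h | h <;> simp [b₁, b₂, h]
    ring)
  have hs : ∀ c, ∃ s : Lam, z c = ((K (D.κ (D.b₁ c)) * D.writhe c : ℤ) : Lam) + (1 - tt) * s :=
    fun c => by
    obtain ⟨s, hs⟩ := exists_eq_aug_add (z c)
    refine ⟨s, ?_⟩
    rw [← hK, mul_right_comm, ← Units.val_mul, Int.units_mul_self, Units.val_one, one_mul]
    exact hs
  choose s hs using hs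
  let v : D.Arc →₀ Lam := ∑ i, K i • ∑ c ∈ D.underCrossings i,
    (D.writhe c : ℤ) • (D.e (D.a c) - D.e (D.b₁ c))
  have h0 : ∑ c, (K (D.κ (D.b₁ c)) * D.writhe c : ℤ) • (D.e (D.b₂ c) - D.e (D.b₁ c)) = 0 := by
    rw [← Finset.sum_fiberwise Finset.univ (fun c => D.κ (D.b₁ c))]
    refine Finset.sum_eq_zero fun i _ => ?_
    rw [← smul_zero (K i), ← D.sum_b₂_sub_b₁ i, Finset.smul_sum]
    refine Finset.sum_congr rfl fun c hc => ?_
    rw [(Finset.mem_filter.1 hc).2, mul_smul]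
  have hv : v = ∑ c, (K (D.κ (D.b₁ c)) * D.writhe c : ℤ) • (D.e (D.a c) - D.e (D.b₁ c)) := by
    rw [← Finset.sum_fiberwise Finset.univ (fun c => D.κ (D.b₁ c))]
    refine Finset.sum_congr rfl fun i _ => ?_
    rw [Finset.smul_sum]
    refine Finset.sum_congr rfl fun c hc => ?_
    rw [(Finset.mem_filter.1 hc).2, mul_smul]
  -- Each relator is (1-t)(a - b₁) + (b₁ - b₂). With z_c = K w(c) + (1-t)s_c, the parts K w(c)(b₁ -
  -- b₂) cancel by `h0`, and everything left is divisible by 1-t.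
  have key : (1 - tt : Lam) • y = (1 - tt : Lam) • (v + D.rho (Finsupp.equivFunOnFinite.symm s)) := by
    change D.rho z = (1 - tt : Lam) • y at hz
    rw [← hz, rho_apply, rho_apply, hv, smul_add, Finset.smul_sum, Finset.smul_sum,
      ← Finset.sum_add_distrib, ← sub_eq_zero, ← Finset.sum_sub_distrib, ← neg_zero, ← h0,
      ← Finset.sum_neg_distrib]
    refine Finset.sum_congr rfl fun c _ => ?_
    rw [hs, Finsupp.equivFunOnFinite_symm_apply_apply]
    module
  -- The factor 1-t is cancelled coordinatewise in the free module over the domain Λ. Modulo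
  -- relations, y is then the combination of longitudes with coefficients K.
  have hy : y = v + D.rho (Finsupp.equivFunOnFinite.symm s) := by
    ext b : 1
    have h := DFunLike.congr_fun key b
    rw [Finsupp.smul_apply, Finsupp.smul_apply, smul_eq_mul, smul_eq_mul] at h
    exact mul_left_cancel₀ one_sub_tt_ne_zero h
  have hl : Submodule.Quotient.mk y = ∑ i, K i • D.longitude i := by
    change D.sig y = _
    have h1 : D.sig (D.rho (Finsupp.equivFunOnFinite.symm s)) = 0 :=
      (Submodule.Quotient.mk_eq_zero _).2 ⟨_, rfl⟩
    rw [hy, map_add, h1, add_zero, map_sum]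
    refine Finset.sum_congr rfl fun i _ => ?_
    rw [map_zsmul, longitude, halfSum, ← Finset.sum_sub_distrib]
    simp only [smul_sub]
  rw [hl]
  exact Submodule.sum_mem _ fun i _ => Submodule.smul_of_tower_mem _ _
    (Submodule.mem_iSup_of_mem i (Submodule.mem_span_singleton_self _))

end LinkDiagram

/-! ## Maps out of presented medial quandles -/

section Presented

variable {A : Type} {r : QTerm A → QTerm A → Prop}

theorem isAbelian_presented (r : QTerm A → QTerm A → Prop) :
    Rack.IsAbelian (PresentedMedialQuandle r) := by
  intro x y z w
  induction x using Quotient.ind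
  induction y using Quotient.ind
  induction z using Quotient.ind
  induction w using Quotient.ind
  exact Quotient.sound (MedialRel.medial _ _ _ _)

/-- The class of a generator. -/
def PresentedMedialQuandle.gen (r : QTerm A → QTerm A → Prop) (a : A) :
    PresentedMedialQuandle r := Quotient.mk (medialSetoid r) (QTerm.gen a)

theorem PresentedMedialQuandle.induction {C : PresentedMedialQuandle r → Prop}
    (hgen : ∀ a, C (gen r a)) (hact : ∀ x y, C x → C y → C (x ◃ y))
    (hinv : ∀ x y, C x → C y → C (x ◃⁻¹ y)) (x : PresentedMedialQuandle r) : C x := by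
  induction x using Quotient.ind with | _ x => ?_
  induction x with
  | gen a => exact hgen a
  | act x y hx hy => exact hact _ _ hx hy
  | invAct x y hx hy => exact hinv _ _ hx hy

/-- The value of a formal expression in a quandle. -/
def QTerm.eval {R : Type*} [Quandle R] (f : A → R) : QTerm A → R
  | .gen a => f a
  | .act x y => x.eval f ◃ y.eval f
  | .invAct x y => x.eval f ◃⁻¹ y.eval f

/-- The universal property of a presented medial quandle. -/
def PresentedMedialQuandle.lift {R : Type*} [Quandle R] (hR : Rack.IsAbelian R) (f : A → R)
    (hf : ∀ x y, r x y → x.eval f = y.eval f) : PresentedMedialQuandle r →◃ R where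
  toFun := Quotient.lift (QTerm.eval f) (by
    intro x y h
    induction h with
    | rel h => exact hf _ _ h
    | refl => rfl
    | symm _ h => exact h.symm
    | trans _ _ h h' => exact h.trans h'
    | congr_act _ _ h h' => exact congrArg₂ Shelf.act h h'
    | congr_invAct _ _ h h' => exact congrArg₂ Rack.invAct h h'
    | idem x => exact Quandle.fix
    | invAct_act x y => exact Rack.invAct_act_eq _ _
    | act_invAct x y => exact Rack.act_invAct_eq _ _
    | medial x y z w => exact hR _ _ _ _)
  map_act' {x y} := by
    induction x using Quotient.ind
    induction y using Quotient.ind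
    rfl

end Presented

namespace PeripheralData

variable {M : Type*} [AddCommGroup M] [Module Lam M] {I : Type*} (P : PeripheralData M I)

theorem nat_act (y z : P.Carrier) : P.nat (y ◃ z) = (1 - tt) • P.nat y + tt • P.nat z := by
  rw [act_eq_vadd, nat_vadd, natSub]
  module

/-- Both sides are translates of w, so the claim reduces to an identity between differences in M. -/
theorem isAbelian_carrier : Rack.IsAbelian P.Carrier := by
  intro x y z w
  simp only [P.act_eq_vadd _ w, P.act_eq_vadd _ (_ +ᵥ w), vadd_vadd]
  congr 1
  apply Subtype.ext
  simp only [natSub, nat_vadd, nat_act, Submodule.coe_add]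
  module

theorem point_eq_point {i j : I} {n n' : P.N} (h : i = j) (hn : (n - n' : M) ∈ P.X i) :
    P.point i n = P.point j n' := by
  subst h
  exact (P.point_eq_point_iff i n n').2 hn

end PeripheralData

namespace LinkDiagram

variable {μ : ℕ} (D : LinkDiagram μ)

/-! ## Sums along a component -/

/-- The total transport along `k` consecutive passages. -/
def pathSum (p : D.Passage) (k : ℕ) : D.AlexMod :=
  -- The index j + 1 occurs because the arc at p already lies after p: the passages crossed are
  -- those following p, up to and including the endpoint.
  ∑ j ∈ Finset.range k, D.transport (D.next^[j + 1] p)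

theorem pathSum_succ (p : D.Passage) (k : ℕ) :
    D.pathSum p (k + 1) = D.pathSum p k + D.transport (D.next^[k + 1] p) :=
  Finset.sum_range_succ _ _

theorem pathSum_add (p : D.Passage) (k l : ℕ) :
    D.pathSum p (k + l) = D.pathSum p k + D.pathSum (D.next^[k] p) l := by
  induction l with
  | zero => simp [pathSum]
  | succ l ih =>
    rw [← add_assoc, pathSum_succ, pathSum_succ, ih, add_assoc, ← Function.iterate_add_apply,
      add_comm (l + 1) k, add_assoc k l 1]

theorem phi_pathSum (p : D.Passage) (k : ℕ) : D.phi (D.pathSum p k) = 0 := by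
  simp [pathSum, phi_transport]

theorem one_sub_smul_pathSum (p : D.Passage) (k : ℕ) :
    (1 - tt) • D.pathSum p k =
      D.arc (D.arcOf (.inl (D.next^[k] p))) - D.arc (D.arcOf (.inl p)) := by
  induction k with
  | zero => simp [pathSum]
  | succ k ih =>
    rw [pathSum_succ, smul_add, ih, one_sub_smul_transport, Function.iterate_succ_apply',
      Equiv.symm_apply_apply]
    abel

theorem comp_iterate_next (p : D.Passage) (k : ℕ) : D.comp (D.next^[k] p) = D.comp p := by
  induction k with
  | zero => rfl
  | succ k ih => rw [Function.iterate_succ_apply', comp_next, ih]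

/-- One full turn meets every passage of the component exactly once, and the transports sum to the
longitude. -/
theorem pathSum_minimalPeriod (p : D.Passage) :
    D.pathSum p (Function.minimalPeriod D.next p) = D.longitude (D.comp p) := by
  have hper : p ∈ Function.periodicPts D.next :=
    D.next.injective.mem_periodicPts p
  rw [← sum_transport, pathSum]
  refine Finset.sum_bij (fun j _ => D.next^[j + 1] p) ?_ ?_ ?_ fun _ _ => rfl
  · intro j _
    simp only [Finset.mem_filter, Finset.mem_univ, true_and, comp_iterate_next]
  · intro j hj k hk h
    rw [Function.iterate_succ_apply', Function.iterate_succ_apply'] at h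
    exact Function.iterate_injOn_Iio_minimalPeriod (Finset.mem_range.1 hj) (Finset.mem_range.1 hk)
      (D.next.injective h)
  · intro q hq
    obtain ⟨k, hk⟩ := D.exists_iterate_next (p := p) (q := D.next.symm q) (by
      have h := D.comp_next (D.next.symm q)
      rw [Equiv.apply_symm_apply] at h
      rw [← h, (Finset.mem_filter.1 hq).2])
    refine ⟨k % Function.minimalPeriod D.next p, Finset.mem_range.2
      (Nat.mod_lt _ (Function.minimalPeriod_pos_of_mem_periodicPts hper)), ?_⟩
    rw [Function.iterate_succ_apply', Function.iterate_mod_minimalPeriod_eq, hk,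
      Equiv.apply_symm_apply]

theorem pathSum_mul_minimalPeriod (p : D.Passage) (s : ℕ) :
    D.pathSum p (Function.minimalPeriod D.next p * s) = s • D.longitude (D.comp p) := by
  induction s with
  | zero => simp [pathSum]
  | succ s ih =>
    have h : D.next^[Function.minimalPeriod D.next p * s] p = p :=
      (Function.isPeriodicPt_minimalPeriod D.next p).mul_const s
    rw [mul_add, mul_one, pathSum_add, ih, h, pathSum_minimalPeriod, succ_nsmul]

/-- Two paths with the same ends differ by a whole number of turns, hence by a multiple of the
longitude. -/
theorem pathSum_sub_mem (p : D.Passage) {k l : ℕ} (h : D.next^[k] p = D.next^[l] p) :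
    D.pathSum p k - D.pathSum p l ∈ Submodule.span Lam {D.longitude (D.comp p)} := by
  wlog hkl : l ≤ k generalizing k l
  · rw [← neg_sub]
    exact neg_mem (this h.symm (le_of_not_ge hkl))
  obtain ⟨r, rfl⟩ := Nat.exists_eq_add_of_le hkl
  have hr : Function.IsPeriodicPt D.next r (D.next^[l] p) := by
    rw [add_comm, Function.iterate_add_apply] at h
    exact h
  obtain ⟨s, rfl⟩ := hr.minimalPeriod_dvd
  rw [pathSum_add, add_sub_cancel_left, pathSum_mul_minimalPeriod, comp_iterate_next]
  exact nsmul_mem (Submodule.mem_span_singleton_self _) s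

theorem longitude_eq_zero {i : Fin μ} (h : ∀ p, D.comp p ≠ i) : D.longitude i = 0 := by
  rw [← sum_transport, Finset.filter_false_of_mem fun p _ => h p, Finset.sum_empty]

/-! ## The map from `MQ(L)` to `Q(N, (m_i), (X_i))` -/

/-- A base passage on each component gets a coordinate from its meridian, and the others add the
transport on the way. Closing up costs a longitude, so the step rule holds only modulo X_i. -/
theorem exists_passage_coordinates [NeZero μ] (m : Fin μ → D.AlexMod)
    (hm : ∀ i, D.IsMeridian i (m i)) : ∃ n : D.Passage → D.AlexMod,
    (∀ p, D.phi (n p) = 0) ∧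
    (∀ p, m (D.comp p) + (1 - tt) • n p = D.arc (D.arcOf (.inl p))) ∧
    ∀ p, n (D.next p) - (D.transport (D.next p) + n p) ∈
      Submodule.span Lam {D.longitude (D.comp p)} := by
  have h1 : ∀ i, (∃ p, D.comp p = i) → ∃ p, D.comp p = i := fun _ h => h
  choose base hbase using h1
  have h2 : ∀ p, ∃ k, D.next^[k] (base (D.comp p) ⟨p, rfl⟩) = p := fun p =>
    D.exists_iterate_next (hbase _ _)
  choose k hk using h2
  have h3 : ∀ i h, ∃ y, D.phi y = 0 ∧ D.arc (D.arcOf (.inl (base i h))) = m i + (1 - tt) • y :=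
    fun i h => (hm i).exists_eq_add D (hbase i h)
  choose y hy hy' using h3
  refine ⟨fun p => y (D.comp p) ⟨p, rfl⟩ + D.pathSum (base (D.comp p) ⟨p, rfl⟩) (k p),
    fun p => ?_, fun p => ?_, fun p => ?_⟩
  · rw [map_add, hy, phi_pathSum, add_zero]
  · rw [smul_add, one_sub_smul_pathSum, ← add_assoc, ← hy', hk]
    abel
  -- The index i is kept free so that comp (next p) can be replaced by comp p in the dependent
  -- choices of `y` and `base`; the second disjunct carries the defining equation of `k (next p)`
  -- along.
  · have key : ∀ i (h : ∃ p, D.comp p = i) (h' : i = D.comp p),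
        y i h + D.pathSum (base i h) (k (D.next p)) - (D.transport (D.next p) +
          (y (D.comp p) ⟨p, rfl⟩ + D.pathSum (base (D.comp p) ⟨p, rfl⟩) (k p))) ∈
        Submodule.span Lam {D.longitude (D.comp p)} ∨ D.next^[k (D.next p)] (base i h) ≠
          D.next p := by
      rintro i h rfl
      by_cases h1 : D.next^[k (D.next p)] (base (D.comp p) h) = D.next p
      · left
        have h2 := D.pathSum_sub_mem (base (D.comp p) h) (k := k (D.next p)) (l := k p + 1)
          (by rw [h1, Function.iterate_succ_apply', hk])
        rw [pathSum_succ, Function.iterate_succ_apply', hk, hbase] at h2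
        convert h2 using 1
        abel
      · exact Or.inr h1
    exact (key _ ⟨D.next p, rfl⟩ (D.comp_next p)).resolve_right fun h => h (hk _)

theorem exists_generator_images [NeZero μ] (m : Fin μ → D.AlexMod)
    (hm : ∀ i, D.IsMeridian i (m i)) : ∃ z : D.Arc → (D.peripheral m hm).Carrier,
    (∀ b, (z b).1 = D.κ b) ∧ (∀ b, (D.peripheral m hm).nat (z b) = D.arc b) ∧
    ∀ c, z (D.b₂ c) = z (D.a c) ◃ z (D.b₁ c) := by
  let P := D.peripheral m hm
  obtain ⟨n, hφ, hn, hn'⟩ := D.exists_passage_coordinates m hm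
  have h3 : ∀ i : {i : Fin μ // ∀ p, D.comp p ≠ i}, ∃ y, D.phi y = 0 ∧
      D.arc (D.arcOf (.inr i)) = m i + (1 - tt) • y :=
    fun i => (hm i).exists_eq_add D rfl
  choose y hy hy' using h3
  let Z : D.Segment → P.Carrier := Sum.elim (fun p => P.point (D.comp p) ⟨n p, hφ p⟩)
    fun i => P.point i.1 ⟨y i, hy i⟩
  have hstep : ∀ p, Z (.inl (D.next p)) =
      (⟨D.transport (D.next p), D.phi_transport _⟩ : P.N) +ᵥ Z (.inl p) := fun p => by
    refine P.point_eq_point (D.comp_next p) ?_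
    rw [comp_next]
    exact hn' p
  -- Segments joined at an overpass get the same point since the transport there is 0.
  let z : D.Arc → P.Carrier := Quot.lift Z (by
    rintro _ _ ⟨p, h⟩
    rw [hstep]
    have h0 : D.transport (D.next p) = 0 := if_pos h
    rw [eq_comm, P.vadd_eq_self_iff]
    change D.transport (D.next p) ∈ _
    rw [h0]
    exact zero_mem _)
  have hz : ∀ b, P.nat (z b) = D.arc b := by
    intro b
    induction b using Quot.ind with | mk s => ?_
    rcases s with p | i
    · exact hn p
    · exact (hy' i).symm
  refine ⟨z, ?_, hz, fun c => ?_⟩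
  · intro b
    induction b using Quot.ind with | mk s => ?_
    rcases s with p | i <;> rfl
  · have h := hstep (D.next.symm (c, false))
    rw [P.act_eq_vadd]
    rw [Equiv.apply_symm_apply] at h
    replace h : z (D.outArc c) =
      (⟨D.transport (c, false), D.phi_transport _⟩ : P.N) +ᵥ z (D.inArc c) := h
    rcases Int.units_eq_one_or (D.writhe c) with hw | hw
    · have h1 : D.b₁ c = D.inArc c := if_pos hw
      have h2 : D.b₂ c = D.outArc c := if_pos hw
      rw [h2, h, ← h1]
      congr 1
      apply Subtype.ext
      simp [PeripheralData.natSub, hz, transport, hw]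
    · have hw' : D.writhe c ≠ 1 := by rw [hw]; decide
      have h1 : D.b₁ c = D.outArc c := if_neg hw'
      have h2 : D.b₂ c = D.inArc c := if_neg hw'
      have h3 : z (D.inArc c) =
          -(⟨D.transport (c, false), D.phi_transport _⟩ : P.N) +ᵥ z (D.outArc c) := by
        rw [h, vadd_vadd, neg_add_cancel, zero_vadd]
      rw [h2, h1, h3]
      congr 1
      apply Subtype.ext
      simp [PeripheralData.natSub, hz, transport, hw, h1]

end LinkDiagram

namespace LinkDiagram

variable {μ : ℕ} (D : LinkDiagram μ)

/-! ## The displacements of `MQ(L)` -/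

/-- The generator `q_b` of `MQ(L)`. -/
def q (b : D.Arc) : D.MQ := PresentedMedialQuandle.gen D.CrossingRel b

theorem q_b₂ (c : D.Crossing) : D.q (D.b₂ c) = D.q (D.a c) ◃ D.q (D.b₁ c) :=
  Quotient.sound (MedialRel.rel (CrossingRel.mk c))

/-- The displacement group of `MQ(L)` as a `Λ`-module. -/
abbrev DisMQ (b₀ : D.Arc) : Type := DisMod D.MQ (isAbelian_presented D.CrossingRel) (D.q b₀)

/-- The map from the Alexander module to the displacements of `MQ(L)`, sending an arc `b` to the
displacement `β_b β_{b₀}⁻¹`. -/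
def disHom (b₀ : D.Arc) : D.AlexMod →ₗ[Lam] D.DisMQ b₀ :=
  Submodule.liftQ _ (Finsupp.linearCombination Lam fun b => DisMod.rel (D.q b))
    (D.range_rho_le _ fun c => by rw [q_b₂, DisMod.rel_act, sub_self])

/-- The displacement of `MQ(L)` given by an element of the Alexander module. -/
def dis (b₀ : D.Arc) (v : D.AlexMod) : Equiv.Perm D.MQ := (D.disHom b₀ v).perm

variable (b₀ : D.Arc)

theorem disHom_arc (b : D.Arc) : D.disHom b₀ (D.arc b) = DisMod.rel (D.q b) := by
  change Finsupp.linearCombination Lam (fun b => (DisMod.rel (D.q b) : D.DisMQ b₀)) (D.e b) = _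
  simp

theorem dis_zero : D.dis b₀ 0 = 1 := by rw [dis, map_zero, DisMod.perm_zero]

theorem dis_add (v w : D.AlexMod) : D.dis b₀ (v + w) = D.dis b₀ v * D.dis b₀ w := by
  rw [dis, map_add, DisMod.perm_add]; rfl

theorem dis_neg (v : D.AlexMod) : D.dis b₀ (-v) = (D.dis b₀ v)⁻¹ := by
  rw [dis, map_neg, DisMod.perm_neg]; rfl

theorem dis_tt_smul (v : D.AlexMod) (x : D.MQ) :
    D.dis b₀ (tt • v) x = D.q b₀ ◃ D.dis b₀ v (D.q b₀ ◃⁻¹ x) := by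
  rw [dis, map_smul, DisMod.perm_tt_smul]
  rfl

theorem dis_arc_sub (b b' : D.Arc) :
    D.dis b₀ (D.arc b - D.arc b') = Rack.act' (D.q b) * (Rack.act' (D.q b'))⁻¹ := by
  rw [dis, map_sub, disHom_arc, disHom_arc, DisMod.perm_sub, DisMod.perm_rel, DisMod.perm_rel]
  group

/-- The elements of the Alexander module whose displacement fixes `x`. -/
def stabilizer (x : D.MQ) : AddSubgroup D.AlexMod where
  carrier := {v | D.dis b₀ v x = x}
  zero_mem' := by rw [Set.mem_ofPred_eq, dis_zero]; rfl
  add_mem' := by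
    intro v w hv hw
    rw [Set.mem_ofPred_eq, dis_add, Equiv.Perm.mul_apply, hw, hv]
  neg_mem' := by
    intro v hv
    rw [Set.mem_ofPred_eq, dis_neg, Equiv.Perm.inv_eq_iff_eq, hv]

theorem mem_stabilizer {v : D.AlexMod} {x : D.MQ} :
    v ∈ D.stabilizer b₀ x ↔ D.dis b₀ v x = x := Iff.rfl

/-- β_{b₁} fixes q_{b₁}, so β_a β_{b₁}⁻¹ carries q_{b₁} to q_{b₁} ▷ q_a = q_{b₂}; at a negative
crossing the inverse is used. -/
theorem dis_transport (p : D.Passage) :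
    D.dis b₀ (D.transport (D.next p)) (D.q (D.arcOf (.inl p))) =
      D.q (D.arcOf (.inl (D.next p))) := by
  obtain ⟨p, rfl⟩ := D.next.symm.surjective p
  rw [Equiv.apply_symm_apply]
  obtain ⟨c, _ | _⟩ := p
  · change D.dis b₀ (D.transport (c, false)) (D.q (D.inArc c)) = D.q (D.outArc c)
    have h : D.dis b₀ (D.arc (D.a c) - D.arc (D.b₁ c)) (D.q (D.b₁ c)) = D.q (D.b₂ c) := by
      rw [dis_arc_sub, q_b₂, Equiv.Perm.mul_apply, Rack.invAct_apply, Quandle.fix_inv]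
      rfl
    rw [transport, if_neg (by simp)]
    rcases Int.units_eq_one_or (D.writhe c) with hw | hw
    · have h1 : D.b₁ c = D.inArc c := if_pos hw
      have h2 : D.b₂ c = D.outArc c := if_pos hw
      rw [← h1, ← h2, hw, Units.val_one, one_smul, h]
    · have hw' : D.writhe c ≠ 1 := by rw [hw]; decide
      have h1 : D.b₁ c = D.outArc c := if_neg hw'
      have h2 : D.b₂ c = D.inArc c := if_neg hw'
      rw [← h1, ← h2, hw, Units.val_neg, Units.val_one, neg_smul, one_smul, dis_neg,
        Equiv.Perm.inv_eq_iff_eq, h]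
  · rw [arcOf_next_symm_over, transport, if_pos rfl, dis_zero]
    rfl

theorem dis_pathSum (p : D.Passage) (k : ℕ) :
    D.dis b₀ (D.pathSum p k) (D.q (D.arcOf (.inl p))) = D.q (D.arcOf (.inl (D.next^[k] p))) := by
  induction k with
  | zero => simp [pathSum, dis_zero]
  | succ k ih =>
    rw [pathSum_succ, add_comm, dis_add, Equiv.Perm.mul_apply, ih, Function.iterate_succ_apply',
      dis_transport]

/-- The longitude of `K_i` fixes the generators that come from arcs of `K_i`. -/
theorem longitude_mem_stabilizer (b : D.Arc) : D.longitude (D.κ b) ∈ D.stabilizer b₀ (D.q b) := by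
  induction b using Quot.ind with | mk s => ?_
  rcases s with p | i
  · have h := D.dis_pathSum b₀ p (Function.minimalPeriod D.next p)
    rw [pathSum_minimalPeriod, Function.iterate_minimalPeriod] at h
    exact h
  · change D.longitude i.1 ∈ _
    rw [D.longitude_eq_zero i.2]
    exact zero_mem _

theorem exists_dis_of_κ_eq {b b' : D.Arc} (h : D.κ b = D.κ b') :
    ∃ v, D.dis b₀ v (D.q b) = D.q b' := by
  refine D.arc_induction (C := fun b' => ∃ v, D.dis b₀ v (D.q b) = D.q b') ?_ h
    ⟨0, by rw [dis_zero]; rfl⟩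
  rintro p ⟨v, hv⟩
  exact ⟨D.transport (D.next p) + v, by
    rw [dis_add, Equiv.Perm.mul_apply, hv, dis_transport]⟩

/-- Being affine in x, the elements β_x β_{b₀}⁻¹ lie in the submodule spanned by those of the
generators. -/
theorem rel_mem_range (x : D.MQ) : DisMod.rel x ∈ LinearMap.range (D.disHom b₀) := by
  induction x using PresentedMedialQuandle.induction with
  | hgen b => exact ⟨_, D.disHom_arc b₀ b⟩
  | hact x y hx hy =>
    rw [DisMod.rel_act]
    exact add_mem (Submodule.smul_mem _ _ hx) (Submodule.smul_mem _ _ hy)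
  | hinv x y hx hy =>
    rw [DisMod.rel_invAct]
    exact add_mem (Submodule.smul_mem _ _ hx) (Submodule.smul_mem _ _ hy)

theorem exists_dis_eq_act_invAct (x y : D.MQ) : ∃ v, ∀ z, D.dis b₀ v z = x ◃ (y ◃⁻¹ z) := by
  obtain ⟨v, hv⟩ := sub_mem (D.rel_mem_range b₀ x) (D.rel_mem_range b₀ y)
  refine ⟨v, fun z => ?_⟩
  rw [dis, hv, DisMod.perm_sub, DisMod.perm_rel, DisMod.perm_rel, mul_inv_rev, inv_inv, mul_assoc,
    inv_mul_cancel_left]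
  rfl

/-- Every element of `MQ(L)` lies in the orbit of a generator. -/
theorem exists_dis_generator (x : D.MQ) : ∃ v b, D.dis b₀ v (D.q b) = x := by
  induction x using PresentedMedialQuandle.induction with
  | hgen b => exact ⟨0, b, by rw [dis_zero]; rfl⟩
  | hact x y _ hy =>
    obtain ⟨v, b, rfl⟩ := hy
    -- On y, the translation by x agrees with the displacement β_x β_y⁻¹, because y is fixed by β_y.
    obtain ⟨w, hw⟩ := D.exists_dis_eq_act_invAct b₀ x (D.dis b₀ v (D.q b))
    refine ⟨w + v, b, ?_⟩
    rw [dis_add, Equiv.Perm.mul_apply, hw]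
    rw [Quandle.fix_inv]
  | hinv x y _ hy =>
    obtain ⟨v, b, h⟩ := hy
    obtain ⟨w, hw⟩ := D.exists_dis_eq_act_invAct b₀ (x ◃⁻¹ y) x
    refine ⟨w + v, b, ?_⟩
    rw [dis_add, Equiv.Perm.mul_apply, h, hw, Quandle.fix]

/-! ## The isomorphism -/

section Iso

variable [NeZero μ] (m : Fin μ → D.AlexMod) (hm : ∀ i, D.IsMeridian i (m i))

/-- The projection of the Alexander module onto `ker φ` along the arc `b₀`. -/
def proj : D.AlexMod →ₗ[Lam] (D.peripheral m hm).N :=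
  LinearMap.codRestrict _ (LinearMap.id - D.phi.smulRight (D.arc b₀)) fun v => by
    change D.phi (v - D.phi v • D.arc b₀) = 0
    rw [map_sub, map_smul, phi_sig_e, smul_eq_mul, mul_one, sub_self]

theorem coe_proj (v : D.AlexMod) : (D.proj b₀ m hm v : D.AlexMod) = v - D.phi v • D.arc b₀ := rfl

/-- For an arc, β_b β_{b₀}⁻¹ goes to translation by b - b₀. This extends to all of M because t is
conjugation by β_{b₀} in MQ(L) and by its image in the target (`act_vadd`). -/
theorem map_dis (f : D.MQ →◃ (D.peripheral m hm).Carrier)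
    (hf : ∀ b, (D.peripheral m hm).nat (f (D.q b)) = D.arc b) (v : D.AlexMod) :
    ∀ x, f (D.dis b₀ v x) = D.proj b₀ m hm v +ᵥ f x := by
  let P := D.peripheral m hm
  let S : AddSubgroup D.AlexMod :=
    { carrier := {v | ∀ x, f (D.dis b₀ v x) = D.proj b₀ m hm v +ᵥ f x}
      zero_mem' := fun x => by rw [dis_zero, map_zero, zero_vadd]; rfl
      add_mem' := fun {v w} hv hw x => by
        rw [dis_add, Equiv.Perm.mul_apply, hv, hw, map_add, add_vadd]
      neg_mem' := fun {v} hv x => by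
        have h := hv (D.dis b₀ (-v) x)
        rw [← Equiv.Perm.mul_apply, ← dis_add, add_neg_cancel, dis_zero] at h
        change f x = _ at h
        rw [h, vadd_vadd, ← map_add, neg_add_cancel, map_zero, zero_vadd] }
  change v ∈ S
  have htt : ∀ v x, f (D.dis b₀ (tt • v) x) = f (D.q b₀) ◃ f (D.dis b₀ v (D.q b₀ ◃⁻¹ x)) := by
    intro v x
    rw [dis_tt_smul, ShelfHom.map_act]
  induction v using D.alexMod_induction with
  | hz => exact zero_mem _
  | hadd v w hv hw => exact add_mem hv hw
  | hs r b =>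
    refine S.lam_smul_mem (fun v hv x => ?_) (fun v hv x => ?_) r fun x => ?_
    · rw [htt, hv, PeripheralData.act_vadd, ← ShelfHom.map_act, Rack.act_invAct_eq, map_smul]
    · have h := htt (ti • v) (D.q b₀ ◃ x)
      rw [tt_smul_ti, hv, Rack.invAct_act_eq, ShelfHom.map_act, ← tt_smul_ti (D.proj b₀ m hm v),
        ← PeripheralData.act_vadd, Rack.left_cancel, ← map_smul] at h
      exact h.symm
    · have h : D.dis b₀ (D.arc b) x = D.q b ◃ (D.q b₀ ◃⁻¹ x) := by
        rw [dis, disHom_arc]; rfl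
      rw [h, ShelfHom.map_act, ShelfHom.map_invAct, PeripheralData.act_invAct_eq_vadd]
      congr 1
      apply Subtype.ext
      rw [coe_proj, phi_sig_e, one_smul]
      change P.nat _ - P.nat _ = _
      rw [hf, hf]

/-- Two elements with equal image lie over one component, so they differ by a displacement whose
translation stabilizes N/X_i. That translation is by a multiple of χ_i, and χ_i fixes q_b in MQ(L).
-/
theorem map_injective (f : D.MQ →◃ (D.peripheral m hm).Carrier)
    (hf : ∀ b, (D.peripheral m hm).nat (f (D.q b)) = D.arc b)
    (hf' : ∀ b, (f (D.q b)).1 = D.κ b) : Function.Injective f := by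
  let P := D.peripheral m hm
  intro x y hxy
  let b₀ : D.Arc := (D.κ_surjective 0).choose
  obtain ⟨v, b, rfl⟩ := D.exists_dis_generator b₀ x
  obtain ⟨w, b', rfl⟩ := D.exists_dis_generator b₀ y
  have hmap := D.map_dis b₀ m hm f hf
  have hκ : D.κ b = D.κ b' := by
    have h := hxy
    rw [hmap, hmap] at h
    exact (hf' b).symm.trans ((congrArg Sigma.fst h).trans (hf' b'))
  obtain ⟨s, hs⟩ := D.exists_dis_of_κ_eq b₀ hκ
  rw [← hs, ← Equiv.Perm.mul_apply, ← dis_add] at hxy ⊢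
  have h1 : D.proj b₀ m hm (v - (w + s)) +ᵥ f (D.q b) = f (D.q b) := by
    rw [hmap, hmap] at hxy
    rw [map_sub, sub_eq_neg_add, add_vadd, hxy, vadd_vadd, neg_add_cancel, zero_vadd]
  rw [P.vadd_eq_self_iff, hf'] at h1
  obtain ⟨r, hr⟩ := Submodule.mem_span_singleton.1 h1
  rw [coe_proj] at hr
  have hstab : v - (w + s) ∈ D.stabilizer b₀ (D.q b) := by
    obtain ⟨r', hr'⟩ := exists_eq_aug_add r
    -- The stabilizer is only known to be an additive subgroup; (1-t)χ_i = 0 lets the integer aug(r)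
    -- replace r.
    have h2 : r • D.longitude (D.κ b) = aug r • D.longitude (D.κ b) := by
      conv_lhs => rw [hr', add_smul, mul_comm, mul_smul, one_sub_smul_longitude, smul_zero,
        add_zero, Int.cast_smul_eq_zsmul]
    have h3 : D.dis b₀ (v - (w + s)) = D.dis b₀ (r • D.longitude (D.κ b)) := by
      -- The arc b₀ acts trivially, so projecting to N along it does not change the displacement.
      have h4 : D.disHom b₀ (D.arc b₀) = 0 := by
        rw [disHom_arc]
        exact DisMod.perm_injective (mul_inv_cancel _)
      rw [hr, dis, dis, map_sub _ _ (_ • _), map_smul, h4, smul_zero, sub_zero]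
    rw [mem_stabilizer, h3, h2]
    exact zsmul_mem (D.longitude_mem_stabilizer b₀ b) _
  rw [← sub_add_cancel v (w + s), add_comm, dis_add, Equiv.Perm.mul_apply,
    (D.mem_stabilizer b₀).1 hstab]

/-- The projection is the identity on N, so every translation by N comes from a displacement, and N
is transitive on each piece. -/
theorem map_surjective (f : D.MQ →◃ (D.peripheral m hm).Carrier)
    (hf : ∀ b, (D.peripheral m hm).nat (f (D.q b)) = D.arc b)
    (hf' : ∀ b, (f (D.q b)).1 = D.κ b) : Function.Surjective f := by
  let P := D.peripheral m hm
  intro z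
  obtain ⟨b, hb⟩ := D.κ_surjective z.1
  obtain ⟨n, rfl⟩ := P.exists_vadd_eq ((hf' b).trans hb)
  refine ⟨D.dis b n.1 (D.q b), ?_⟩
  rw [D.map_dis b m hm f hf]
  congr 1
  apply Subtype.ext
  have h : D.phi n.1 = 0 := n.2
  rw [coe_proj, h, zero_smul, sub_zero]

theorem exists_iso : ∃ f : D.MQ →◃ (D.peripheral m hm).Carrier, Function.Bijective f := by
  obtain ⟨z, hz, hz', h⟩ := D.exists_generator_images m hm
  let f : D.MQ →◃ (D.peripheral m hm).Carrier :=
    PresentedMedialQuandle.lift (D.peripheral m hm).isAbelian_carrier z (by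
      rintro _ _ ⟨c⟩
      exact h c)
  exact ⟨f, D.map_injective m hm f hz' hz, D.map_surjective m hm f hz' hz⟩

end Iso

end LinkDiagram

end

/-! ### The isomorphism and the universal property of the natural image. -/

theorem mainTheorem4 {μ : ℕ} [NeZero μ] (D : LinkDiagram μ)
    (m : Fin μ → D.AlexMod) (hm : ∀ i, D.IsMeridian i (m i)) :
    (∃ e : D.MQ →◃ (D.peripheral m hm).Carrier, Function.Bijective e) ∧
    ∀ e : D.MQ →◃ (D.peripheral m hm).Carrier, Function.Bijective e →
      Function.Surjective (D.naturalMap m hm e) ∧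
      Rack.IsAbelian (D.QAred m hm) ∧
      Semiregular (D.QAred m hm) ∧
      ∀ (Q : Type*) [Quandle Q], Rack.IsAbelian Q → Semiregular Q →
        ∀ g : D.MQ →◃ Q, Function.Surjective g →
          ∃! g' : D.QAred m hm →◃ Q, g'.comp (D.naturalMap m hm e) = g := by
  refine ⟨D.exists_iso m hm, fun e he => ?_⟩
  let P := D.peripheral m hm
  have hsurj : Function.Surjective (D.naturalMap m hm e) := by
    rintro ⟨_, z, rfl⟩
    obtain ⟨x, rfl⟩ := he.2 z
    exact ⟨x, rfl⟩
  refine ⟨hsurj, isAbelian_quandleImage _ (isAbelian_affine _), affine_semiregular _,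
    fun Q _ _ hQ g _ => ?_⟩
  let E : D.MQ ≃ P.Carrier := Equiv.ofBijective e he
  let h : P.Carrier →◃ Q :=
    { toFun := fun z => g (E.symm z)
      map_act' := fun {x y} => by
        rw [← g.map_act]
        congr 1
        rw [Equiv.symm_apply_eq]
        change x ◃ y = e (E.symm x ◃ E.symm y)
        rw [e.map_act]
        exact congrArg₂ Shelf.act (E.apply_symm_apply x).symm (E.apply_symm_apply y).symm }
  have hh : ∀ x, h (e x) = g x := fun x => congrArg g (E.symm_apply_apply x)
  -- Equal values of the natural map force equal values of g; this is all that is needed to define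
  -- g' through a section of the natural map.
  have hfac : ∀ x y, D.naturalMap m hm e x = D.naturalMap m hm e y → g x = g y := by
    intro x y hxy
    rw [← hh, ← hh]
    exact P.eq_of_nat_eq hQ h (fun _ _ _ hn => D.eq_of_meridian_sub m hm hn)
      (D.exists_mem_span_diff m hm) (fun _ _ hx => D.mem_iSup_longitude hx)
      (congrArg Subtype.val hxy)
  let s := Function.surjInv hsurj
  have hs : ∀ y, D.naturalMap m hm e (s y) = y := Function.surjInv_eq hsurj
  refine ⟨{ toFun := fun y => g (s y), map_act' := fun {x y} => ?_ }, ?_, fun g' hg' => ?_⟩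
  · rw [← g.map_act]
    apply hfac
    rw [ShelfHom.map_act, hs, hs, hs]
  · exact ShelfHom.ext (funext fun x => hfac _ _ (hs _))
  · refine ShelfHom.ext (funext fun y => ?_)
    change g' y = g (s y)
    rw [← hg', ShelfHom.comp_apply, hs]
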